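/- Let $a\ge 2$ and let $F=\breve F(a,1,a,1,a)$ be the fence with $n=3a+1$ elements $x_1,\dots,x_n$ and partial order $\unlhd$ generated by the cover relations $$x_1\lhd\cdots\lhd x_a\rhd x_{a+1}\lhd x_{a+2}\lhd\cdots\lhd x_{2a+1}\rhd x_{2a+2}\lhd x_{2a+3}\lhd\cdots\lhd x_{3a+1}.$$ Rowmotion on antichains is the permutation $\rho$ sending an antichain $A$ of $F$ to the set of minimal elements of the complement of the (lower order) ideal generated by $A$. Rowmotion on ideals is the permutation $\hat\rho$ sending an ideal $I$ to the ideal generated by the minimal elements of $F\setminus I$. An orbit $\mathcal O$ of $\rho$ corresponds to the orbit $\hat{\mathcal O}$ of $\hat\rho$ consisting of the ideals generated by the antichains in $\mathcal O$. For an antichain $A$ let $\chi(A)=\#A$, and for an orbit $\mathcal O$ of $\rho$ let $\chi(\mathcal O)=\sum_{A\in\mathcal O}\#A$. The statistic $\chi$ is orbomesic if $\chi(\mathcal O_1)=\chi(\mathcal O_2)$ for any two orbits $\mathcal O_1,\mathcal O_2$ of $\rho$ with $\#\mathcal O_1=\#\mathcal O_2$. The poset $F$ is self-dual. If $\kappa:F\to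 F$ is an order-reversing bijection, the superorbits with respect to $\kappa$ are the orbits, on the set of ideals of $F$, of the group generated by $\hat\rho$ and the ideal complement $I\mapsto\kappa(F\setminus I)$. The set of orbits of $\rho$ can be partitioned into three classes $\mathcal S$, $\mathcal M$, $\mathcal L$ (small, medium and large orbits) with the following properties. (a) $\#\mathcal S=2a-2$, $\#\mathcal M=1$, $\#\mathcal L=a$; and $\#\mathcal O=a+1$ if $\mathcal O\in\mathcal S$, $\#\mathcal O=3a+2$ if $\mathcal O\in\mathcal M$, $\#\mathcal O=a^2+2a$ if $\mathcal O\in\mathcal L$. (b) $\chi(\mathcal O)=3a$ if $\mathcal O\in\mathcal S$, $\chi(\mathcal O)=9a-3$ if $\mathcal O\in\mathcal M$, and $\chi(\mathcal O)=3a^2+3a-2$ if $\mathcal O\in\mathcal L$. If $a\ne 2$, then $\chi$ is orbomesic. (c) For every order-reversing bijection $\kappa:F\to F$ the superorbits are the sets $\hat{\mathcal O}$ with $\mathcal O\in\mathcal M\cup\mathcal L$, together with the sets $\hat{\mathcal O}_1\cup\hat{\mathcal O}_2$ for pairs of distinct orbits $\mathcal O_1,\mathcal O_2\in\mathcal S$,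 each orbit in $\mathcal S$ belonging to exactly one such pair. -/

import Mathlib

/-! ### Fences -/

/-- For a composition `α = (α₁, …, αₛ)`, `fenceStepUp α j` tells whether `x_j ⊲ x_{j+1}` (`true`) or
`x_j ⊳ x_{j+1}` (`false`) in the fence of `α`. The steps go up along the first segment, and change
direction at the shared elements, which are the `x_k` with `k = α₁ + ⋯ + αᵢ`, `i < s`. -/
def fenceStepUp : List ℕ → ℕ → Bool
  | [], _ => true
  | a :: l, j => if j < a then true else !fenceStepUp l (j - a)

/-- The underlying set `{x₁, …, xₙ}`, `n = α₁ + ⋯ + αₛ - 1`, of the fence of `α`.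
The element `x_{k+1}` is represented by the index `k`. -/
def Fence (α : List ℕ) : Type := Fin (α.sum - 1)

instance (α : List ℕ) : Fintype (Fence α) := inferInstanceAs (Fintype (Fin (α.sum - 1)))

instance (α : List ℕ) : DecidableEq (Fence α) := inferInstanceAs (DecidableEq (Fin (α.sum - 1)))

/-- The 0-based position of an element of a fence. -/
def Fence.pos {α : List ℕ} (x : Fence α) : ℕ := Fin.val x

theorem Fence.pos_injective {α : List ℕ} : Function.Injective (Fence.pos (α := α)) :=
  fun _ _ h => Fin.ext h

/-- The fence order: `x ≤ y` when all steps on the path from `x` to `y` in the Hasse diagram go up.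
When `y` is on the left of `x`, this says that all steps read from left to right go down. -/
instance (α : List ℕ) : PartialOrder (Fence α) where
  le x y :=
    (x.pos ≤ y.pos ∧ ∀ k, x.pos ≤ k → k < y.pos → fenceStepUp α (k + 1) = true) ∨
    (y.pos ≤ x.pos ∧ ∀ k, y.pos ≤ k → k < x.pos → fenceStepUp α (k + 1) = false)
  le_refl x := Or.inl ⟨le_rfl, fun k h1 h2 => absurd h2 (not_lt.mpr h1)⟩
  le_trans x y z := by
    rintro (⟨h1, h2⟩ | ⟨h1, h2⟩) (⟨h3, h4⟩ | ⟨h3, h4⟩)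
    · refine Or.inl ⟨h1.trans h3, fun k hk hk' => ?_⟩
      rcases lt_or_ge k y.pos with h | h
      · exact h2 k hk h
      · exact h4 k h hk'
    · rcases h1.eq_or_lt with h | h
      · exact Or.inr ⟨by omega, fun k hk hk' => h4 k hk (by omega)⟩
      · rcases h3.eq_or_lt with h' | h'
        · exact Or.inl ⟨by omega, fun k hk hk' => h2 k hk (by omega)⟩
        · have e1 := h2 (y.pos - 1) (by omega) (by omega)
          have e2 := h4 (y.pos - 1) (by omega) (by omega)
          rw [e1] at e2
          cases e2
    · rcases h1.eq_or_lt with h | h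
      · exact Or.inl ⟨by omega, fun k hk hk' => h4 k (by omega) hk'⟩
      · rcases h3.eq_or_lt with h' | h'
        · exact Or.inr ⟨by omega, fun k hk hk' => h2 k (by omega) hk'⟩
        · have e1 := h2 y.pos le_rfl h
          have e2 := h4 y.pos le_rfl h'
          rw [e1] at e2
          cases e2
    · refine Or.inr ⟨h3.trans h1, fun k hk hk' => ?_⟩
      rcases lt_or_ge k y.pos with h | h
      · exact h4 k hk h
      · exact h2 k h hk'
  le_antisymm x y := by
    rintro (⟨h1, h2⟩ | ⟨h1, h2⟩) (⟨h3, h4⟩ | ⟨h3, h4⟩)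
    · exact Fence.pos_injective (le_antisymm h1 h3)
    · rcases h1.eq_or_lt with h | h
      · exact Fence.pos_injective h
      · have e1 := h2 x.pos le_rfl h
        rw [h4 x.pos le_rfl h] at e1
        cases e1
    · rcases h1.eq_or_lt with h | h
      · exact Fence.pos_injective h.symm
      · have e1 := h2 y.pos le_rfl h
        rw [h4 y.pos le_rfl h] at e1
        cases e1
    · exact Fence.pos_injective (le_antisymm h3 h1)

/-! ### Antichains, ideals and rowmotion -/

/-- The set of antichains of a poset. -/
def Antichains (P : Type*) [PartialOrder P] : Type _ :=
  {A : Set P // IsAntichain (· ≤ ·) A}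

instance (P : Type*) [PartialOrder P] [Finite P] : Finite (Antichains P) :=
  inferInstanceAs (Finite {A : Set P // IsAntichain (· ≤ ·) A})

/-- `Δ`: an ideal is sent to the antichain of its maximal elements.
The inverse sends an antichain to the ideal that it generates. -/
def idealToAntichain (P : Type*) [PartialOrder P] [Finite P] : LowerSet P ≃ Antichains P where
  toFun I := ⟨{x | Maximal (· ∈ I) x}, setOfPred_maximal_antichain (· ∈ I)⟩
  invFun A := lowerClosure A.1
  left_inv I := by
    ext x
    constructor
    · rintro ⟨y, hy, hxy⟩
      exact I.lower hxy hy.prop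
    · intro hx
      obtain ⟨y, hxy, hy⟩ := (Set.toFinite (I : Set P)).exists_le_maximal hx
      exact ⟨y, hy, hxy⟩
  right_inv A := by
    apply Subtype.ext
    ext x
    constructor
    · rintro ⟨⟨y, hy, hxy⟩, h⟩
      have hyx : y ≤ x := h (subset_lowerClosure hy) hxy
      exact le_antisymm hxy hyx ▸ hy
    · intro hx
      refine ⟨subset_lowerClosure hx, ?_⟩
      rintro y ⟨z, hz, hyz⟩ hxy
      have : x = z := A.2.eq hx hz (hxy.trans hyz)
      exact this ▸ hyz

/-- `∇`: an upper order ideal is sent to the antichain of its minimal elements.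
The inverse sends an antichain to the upper order ideal that it generates. -/
def filterToAntichain (P : Type*) [PartialOrder P] [Finite P] : UpperSet P ≃ Antichains P where
  toFun U := ⟨{x | Minimal (· ∈ U) x}, setOfPred_minimal_antichain (· ∈ U)⟩
  invFun A := upperClosure A.1
  left_inv U := by
    ext x
    constructor
    · rintro ⟨y, hy, hxy⟩
      exact U.upper hxy hy.prop
    · intro hx
      obtain ⟨y, hxy, hy⟩ := (Set.toFinite (U : Set P)).exists_le_minimal hx
      exact ⟨y, hy, hxy⟩
  right_inv A := by
    apply Subtype.ext
    ext x
    constructor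
    · rintro ⟨⟨y, hy, hxy⟩, h⟩
      have hyx : x ≤ y := h (subset_upperClosure hy) hxy
      exact le_antisymm hxy hyx ▸ hy
    · intro hx
      refine ⟨subset_upperClosure hx, ?_⟩
      rintro y ⟨z, hz, hyz⟩ hxy
      have : z = x := A.2.eq hz hx (hyz.trans hxy)
      exact this ▸ hyz

/-- `c`: the set complement, from ideals to upper order ideals. -/
def complEquiv (P : Type*) [PartialOrder P] : LowerSet P ≃ UpperSet P where
  toFun I := I.compl
  invFun U := U.compl
  left_inv I := I.compl_compl
  right_inv U := U.compl_compl

/-- Rowmotion on antichains, `ρ = ∇ ∘ c ∘ Δ⁻¹`. -/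
def rowmotion (P : Type*) [PartialOrder P] [Finite P] : Equiv.Perm (Antichains P) :=
  ((idealToAntichain P).symm.trans (complEquiv P)).trans (filterToAntichain P)

/-- Rowmotion on ideals, `ρ̂ = Δ⁻¹ ∘ ∇ ∘ c`. -/
def idealRowmotion (P : Type*) [PartialOrder P] [Finite P] : Equiv.Perm (LowerSet P) :=
  ((complEquiv P).trans (filterToAntichain P)).trans (idealToAntichain P).symm

/-- The ideal complement `I ↦ κ(c(I))` with respect to an order-reversing bijection `κ` of `P`:
an element `x` lies in `κ(c(I))` if and only if `κ⁻¹(x)` does not lie in `I`. -/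
def idealComplement {P : Type*} [PartialOrder P] (κ : P ≃o Pᵒᵈ) : Equiv.Perm (LowerSet P) where
  toFun I := ⟨{x | κ.symm (OrderDual.toDual x) ∉ I}, fun _ _ hyx hx hy =>
    hx (I.lower (κ.symm.monotone (OrderDual.toDual_le_toDual.mpr hyx)) hy)⟩
  invFun I := ⟨{x | OrderDual.ofDual (κ x) ∉ I}, fun _ _ hyx hx hy =>
    hx (I.lower (OrderDual.ofDual_le_ofDual.mpr (κ.monotone hyx)) hy)⟩
  left_inv I := by
    ext x
    change ¬ (κ.symm (OrderDual.toDual (OrderDual.ofDual (κ x))) ∉ I) ↔ x ∈ I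
    simp
  right_inv I := by
    ext x
    change ¬ (OrderDual.ofDual (κ (κ.symm (OrderDual.toDual x))) ∉ I) ↔ x ∈ I
    simp

/-! ### Orbits and statistics -/

/-- The set of orbits of a group of permutations of `X`. -/
def permOrbits {X : Type*} (G : Subgroup (Equiv.Perm X)) : Set (Set X) :=
  Set.range fun x : X => MulAction.orbit G x

/-- The orbits of rowmotion on antichains. -/
def rowmotionOrbits (P : Type*) [PartialOrder P] [Finite P] : Set (Set (Antichains P)) :=
  permOrbits (Subgroup.zpowers (rowmotion P))

/-- The superorbits with respect to `κ`: the orbits, on ideals, of the group generated by rowmotion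
and the ideal complement. -/
def superorbits {P : Type*} [PartialOrder P] [Finite P] (κ : P ≃o Pᵒᵈ) : Set (Set (LowerSet P)) :=
  permOrbits (Subgroup.closure {idealRowmotion P, idealComplement κ})

/-- The set of ideals generated by the antichains in `O`. -/
def idealsOf {P : Type*} [PartialOrder P] [Finite P] (O : Set (Antichains P)) : Set (LowerSet P) :=
  (idealToAntichain P).symm '' O

/-- The total value `st(O) = ∑_{x ∈ O} st(x)` of a statistic on a subset of a finite set. -/
noncomputable def statSum {X : Type*} [Finite X] (st : X → ℕ) (O : Set X) : ℕ :=
  ∑ᶠ x ∈ O, st x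

/-- A statistic is orbomesic if its total is the same on any two orbits of the same size. -/
def IsOrbomesic {X : Type*} [Finite X] (G : Subgroup (Equiv.Perm X)) (st : X → ℕ) : Prop :=
  ∀ O₁ ∈ permOrbits G, ∀ O₂ ∈ permOrbits G,
    O₁.ncard = O₂.ncard → statSum st O₁ = statSum st O₂

/-- The statistic `χ(A) = #A` on antichains. -/
noncomputable def chi {P : Type*} [PartialOrder P] (A : Antichains P) : ℕ := A.1.ncard

/-! The fence consists of three chains with `a`, `a + 1` and `a` elements; the only relations
between chains are that the bottom of the second lies below the top of the first, and the bottom of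
the third below the top of the second. An ideal is thus a triple `(i, j, k)` of lengths of initial
segments, and rowmotion raises each coordinate by one or resets it. A reset leads to 0, or to 1 when
the chain on the left has just become full.

While the middle coordinate climbs from 1 to `a`, the outer ones rotate freely modulo `a + 1`. So it
suffices to follow the returns to the set `resets`: `(i, 0, k)` with `k ≠ 1` returns after `a + 2`
steps; `i` advances in the cycle `0, …, a - 1` and `k` in the cycle `0, 2, …, a`. Two cycles of
length `a` give `a` large orbits of `a` returns each (`run_large`). `(i, 0, 1)` with `i ≤ a - 2`,
and `(a, 1, k)` with `k ≠ 1, 2`, return to themselves after `a + 1` steps: the small orbits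
(`run_small_left`, `run_small_right`). The remaining points `(a, 1, 1)`, `(a, 1, 2)`, `(a - 1, 0,
1)` form one cycle of returns: the medium orbit. The statistic gains 3 per step, less one for every
reset of a coordinate, so it is found by counting resets.

The ideal complement is an involution conjugating rowmotion to its inverse, so a superorbit is an
orbit together with its image. The image of a representative, moved by one step, shows that the
complement fixes the medium and large orbits and exchanges the two families of small ones. Reversal
of positions is the only order-reversing bijection, so the choice of `κ` is immaterial. -/

namespace FenceRowmotion

/-! ### Segments of trajectories -/

/-- Starting from `x`, the map `f` reaches `y` after `n` steps, the total weight on the way (without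
`y`) being `c`, and no point strictly in between lies in `R`. -/
structure Run {X : Type*} (f : X → X) (w : X → ℕ) (R : Set X) (n c : ℕ) (x y : X) : Prop where
  iter : f^[n] x = y
  sum : birkhoffSum f w n x = c
  avoid : ∀ m, 0 < m → m < n → f^[m] x ∉ R

section Run

variable {X : Type*} {f : X → X} {w : X → ℕ} {R R' : Set X} {n c m d : ℕ} {x y z : X}

theorem Run.refl : Run f w R 0 0 x x :=
  ⟨rfl, by simp, fun _ _ h => absurd h (Nat.not_lt_zero _)⟩

theorem Run.trans (h : Run f w R n c x y) (h' : Run f w R m d y z) (hy : n = 0 ∨ y ∉ R) :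
    Run f w R (n + m) (c + d) x z where
  iter := by rw [Nat.add_comm, Function.iterate_add_apply, h.iter, h'.iter]
  sum := by rw [birkhoffSum_add, h.iter, h.sum, h'.sum]
  avoid r h0 hr := by
    rcases lt_trichotomy r n with h1 | h1 | h1
    · exact h.avoid r h0 h1
    · rw [h1, h.iter]
      exact hy.resolve_left (by omega)
    · obtain ⟨s, rfl⟩ := Nat.exists_eq_add_of_lt h1
      rw [show n + s + 1 = (s + 1) + n by omega, Function.iterate_add_apply, h.iter]
      exact h'.avoid _ (by omega) (by omega)

theorem Run.mono (h : Run f w R n c x y) (hR : R' ⊆ R) : Run f w R' n c x y :=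
  ⟨h.iter, h.sum, fun m h0 hm hx => h.avoid m h0 hm (hR hx)⟩

end Run

/-! ### Rowmotion in coordinates -/

/-- Rowmotion on ideals, in terms of the numbers of elements of the ideal on the three chains. -/
def step (a : ℕ) (s : ℕ × ℕ × ℕ) : ℕ × ℕ × ℕ :=
  let i' := if s.1 = a ∨ (s.1 + 1 = a ∧ s.2.1 = 0) then 0 else s.1 + 1
  let j' := if s.2.1 = a + 1 ∨ (s.2.1 = a ∧ s.2.2 = 0) then (if i' = a then 1 else 0)
    else s.2.1 + 1
  let k' := if s.2.2 = a then (if j' = a + 1 then 1 else 0) else s.2.2 + 1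
  (i', j', k')

/-- The number of minimal elements of the complement of an ideal. -/
def weight (a : ℕ) (s : ℕ × ℕ × ℕ) : ℕ :=
  (if s.1 = a ∨ (s.1 + 1 = a ∧ s.2.1 = 0) then 0 else 1) +
  (if s.2.1 = a + 1 ∨ (s.2.1 = a ∧ s.2.2 = 0) then 0 else 1) +
  (if s.2.2 = a then 0 else 1)

/-- The triples that come from ideals. -/
def Valid (a : ℕ) (s : ℕ × ℕ × ℕ) : Prop :=
  s.1 ≤ a ∧ s.2.1 ≤ a + 1 ∧ s.2.2 ≤ a ∧ (s.1 = a → 1 ≤ s.2.1) ∧ (s.2.1 = a + 1 → 1 ≤ s.2.2)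

/-- The coordinates of the ideal complement. -/
def comp (a : ℕ) (s : ℕ × ℕ × ℕ) : ℕ × ℕ × ℕ := (a - s.2.2, a + 1 - s.2.1, a - s.1)

/-- The triples at which the middle coordinate has just been reset. -/
def resets (a : ℕ) : Set (ℕ × ℕ × ℕ) := {s | s.2.1 = 0 ∨ (s.1 = a ∧ s.2.1 = 1)}

section Step

variable {a : ℕ}

/-- The coordinates are settled from left to right: the restart value of each chain depends on the
new value of its left neighbour. The disjunctive form lets linear arithmetic decide all later case
distinctions. -/
theorem step_eq {i j k i' j' k' : ℕ}
    (hi : ((i = a ∨ (i + 1 = a ∧ j = 0)) ∧ i' = 0) ∨ (¬(i = a ∨ (i + 1 = a ∧ j = 0)) ∧ i' = i + 1))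
    (hj : ((j = a + 1 ∨ (j = a ∧ k = 0)) ∧ ((i' = a ∧ j' = 1) ∨ (i' ≠ a ∧ j' = 0))) ∨
      (¬(j = a + 1 ∨ (j = a ∧ k = 0)) ∧ j' = j + 1))
    (hk : (k = a ∧ ((j' = a + 1 ∧ k' = 1) ∨ (j' ≠ a + 1 ∧ k' = 0))) ∨ (k ≠ a ∧ k' = k + 1)) :
    step a (i, j, k) = (i', j', k') := by
  have hi' : (if i = a ∨ (i + 1 = a ∧ j = 0) then 0 else i + 1) = i' := by
    split_ifs <;> omega
  have hj' : (if j = a + 1 ∨ (j = a ∧ k = 0) then (if i' = a then 1 else 0) else j + 1) = j' := by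
    split_ifs <;> omega
  have hk' : (if k = a then (if j' = a + 1 then 1 else 0) else k + 1) = k' := by
    split_ifs <;> omega
  simp only [step, hi', hj', hk']

theorem exists_step_eq (a i j k : ℕ) : ∃ i' j' k', step a (i, j, k) = (i', j', k') ∧
    (((i = a ∨ (i + 1 = a ∧ j = 0)) ∧ i' = 0) ∨
      (¬(i = a ∨ (i + 1 = a ∧ j = 0)) ∧ i' = i + 1)) ∧
    (((j = a + 1 ∨ (j = a ∧ k = 0)) ∧ ((i' = a ∧ j' = 1) ∨ (i' ≠ a ∧ j' = 0))) ∨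
      (¬(j = a + 1 ∨ (j = a ∧ k = 0)) ∧ j' = j + 1)) ∧
    ((k = a ∧ ((j' = a + 1 ∧ k' = 1) ∨ (j' ≠ a + 1 ∧ k' = 0))) ∨ (k ≠ a ∧ k' = k + 1)) := by
  obtain ⟨i', hi⟩ : ∃ i', ((i = a ∨ (i + 1 = a ∧ j = 0)) ∧ i' = 0) ∨
      (¬(i = a ∨ (i + 1 = a ∧ j = 0)) ∧ i' = i + 1) := by
    by_cases h : i = a ∨ (i + 1 = a ∧ j = 0)
    · exact ⟨0, Or.inl ⟨h, rfl⟩⟩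
    · exact ⟨i + 1, Or.inr ⟨h, rfl⟩⟩
  obtain ⟨j', hj⟩ : ∃ j', ((j = a + 1 ∨ (j = a ∧ k = 0)) ∧
      ((i' = a ∧ j' = 1) ∨ (i' ≠ a ∧ j' = 0))) ∨
      (¬(j = a + 1 ∨ (j = a ∧ k = 0)) ∧ j' = j + 1) := by
    by_cases h : j = a + 1 ∨ (j = a ∧ k = 0)
    · by_cases h' : i' = a
      · exact ⟨1, Or.inl ⟨h, Or.inl ⟨h', rfl⟩⟩⟩
      · exact ⟨0, Or.inl ⟨h, Or.inr ⟨h', rfl⟩⟩⟩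
    · exact ⟨j + 1, Or.inr ⟨h, rfl⟩⟩
  obtain ⟨k', hk⟩ : ∃ k', (k = a ∧ ((j' = a + 1 ∧ k' = 1) ∨ (j' ≠ a + 1 ∧ k' = 0))) ∨
      (k ≠ a ∧ k' = k + 1) := by
    by_cases h : k = a
    · by_cases h' : j' = a + 1
      · exact ⟨1, Or.inl ⟨h, Or.inl ⟨h', rfl⟩⟩⟩
      · exact ⟨0, Or.inl ⟨h, Or.inr ⟨h', rfl⟩⟩⟩
    · exact ⟨k + 1, Or.inr ⟨h, rfl⟩⟩
  exact ⟨i', j', k', step_eq hi hj hk, hi, hj, hk⟩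

/-! ### Valid triples and the dihedral relation -/

theorem Valid.step (ha : 2 ≤ a) {s : ℕ × ℕ × ℕ} (hs : Valid a s) : Valid a (step a s) := by
  obtain ⟨i, j, k⟩ := s
  obtain ⟨i', j', k', h, hi, hj, hk⟩ := exists_step_eq a i j k
  rw [h]
  simp only [Valid] at hs ⊢
  omega

theorem Valid.comp {s : ℕ × ℕ × ℕ} (hs : Valid a s) : Valid a (comp a s) := by
  obtain ⟨i, j, k⟩ := s
  simp only [Valid, FenceRowmotion.comp] at hs ⊢
  omega

theorem comp_comp {s : ℕ × ℕ × ℕ} (hs : Valid a s) : comp a (comp a s) = s := by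
  obtain ⟨i, j, k⟩ := s
  simp only [Valid, comp, Prod.mk.injEq] at hs ⊢
  omega

/-- This reflects a fact about any finite self-dual poset: the minimal elements of the complement of
`I` are the maximal elements of the next ideal, and an order-reversing bijection swaps the two
roles. -/
theorem step_comp_step (ha : 2 ≤ a) {s : ℕ × ℕ × ℕ} (hs : Valid a s) :
    step a (comp a (step a s)) = comp a s := by
  obtain ⟨i, j, k⟩ := s
  obtain ⟨i', j', k', h, hi, hj, hk⟩ := exists_step_eq a i j k
  rw [h]
  simp only [Valid, comp] at hs ⊢
  apply step_eq <;> omega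

/-! ### Weights and first returns to the reset set -/

theorem weight_eq {i j k p q r : ℕ}
    (hi : ((i = a ∨ (i + 1 = a ∧ j = 0)) ∧ p = 0) ∨ (¬(i = a ∨ (i + 1 = a ∧ j = 0)) ∧ p = 1))
    (hj : ((j = a + 1 ∨ (j = a ∧ k = 0)) ∧ q = 0) ∨ (¬(j = a + 1 ∨ (j = a ∧ k = 0)) ∧ q = 1))
    (hk : (k = a ∧ r = 0) ∨ (k ≠ a ∧ r = 1)) : weight a (i, j, k) = p + q + r := by
  have h1 : (if i = a ∨ (i + 1 = a ∧ j = 0) then 0 else 1) = p := by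
    rcases hi with ⟨h, h'⟩ | ⟨h, h'⟩ <;> simp only [h, h', if_true, if_false]
  have h2 : (if j = a + 1 ∨ (j = a ∧ k = 0) then 0 else 1) = q := by
    rcases hj with ⟨h, h'⟩ | ⟨h, h'⟩ <;> simp only [h, h', if_true, if_false]
  have h3 : (if k = a then 0 else 1) = r := by
    rcases hk with ⟨h, h'⟩ | ⟨h, h'⟩ <;> simp only [h, h', if_true, if_false]
  simp only [weight, h1, h2, h3]

/-- A single step; `p`, `q`, `r` are the weights collected on the three chains. -/
theorem run_single {i j k i' j' k' p q r : ℕ}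
    (hi : ((i = a ∨ (i + 1 = a ∧ j = 0)) ∧ i' = 0 ∧ p = 0) ∨
      (¬(i = a ∨ (i + 1 = a ∧ j = 0)) ∧ i' = i + 1 ∧ p = 1))
    (hj : ((j = a + 1 ∨ (j = a ∧ k = 0)) ∧ ((i' = a ∧ j' = 1) ∨ (i' ≠ a ∧ j' = 0)) ∧ q = 0) ∨
      (¬(j = a + 1 ∨ (j = a ∧ k = 0)) ∧ j' = j + 1 ∧ q = 1))
    (hk : (k = a ∧ ((j' = a + 1 ∧ k' = 1) ∨ (j' ≠ a + 1 ∧ k' = 0)) ∧ r = 0) ∨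
      (k ≠ a ∧ k' = k + 1 ∧ r = 1)) :
    Run (step a) (weight a) (resets a) 1 (p + q + r) (i, j, k) (i', j', k') where
  iter := step_eq (hi.imp (fun h => ⟨h.1, h.2.1⟩) fun h => ⟨h.1, h.2.1⟩)
    (hj.imp (fun h => ⟨h.1, h.2.1⟩) fun h => ⟨h.1, h.2.1⟩)
    (hk.imp (fun h => ⟨h.1, h.2.1⟩) fun h => ⟨h.1, h.2.1⟩)
  sum := by
    rw [birkhoffSum_one]
    exact weight_eq (hi.imp (fun h => ⟨h.1, h.2.2⟩) fun h => ⟨h.1, h.2.2⟩)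
      (hj.imp (fun h => ⟨h.1, h.2.2⟩) fun h => ⟨h.1, h.2.2⟩)
      (hk.imp (fun h => ⟨h.1, h.2.2⟩) fun h => ⟨h.1, h.2.2⟩)
  avoid m h0 h1 := by omega

/-- As long as the middle coordinate is neither `0` nor `a + 1`, the outer ones rotate freely. -/
theorem run_middle {n i j k i' k' p r : ℕ} (hj : 1 ≤ j) (hn : j + n ≤ a)
    (hi : (i + n ≤ a ∧ i' = i + n ∧ p = n) ∨ (i ≤ a ∧ a < i + n ∧ i' + (a + 1) = i + n ∧ p + 1 = n))
    (hk : (k + n ≤ a ∧ k' = k + n ∧ r = n) ∨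
      (k ≤ a ∧ a < k + n ∧ k' + (a + 1) = k + n ∧ r + 1 = n)) :
    Run (step a) (weight a) (resets a) n (p + n + r) (i, j, k) (i', j + n, k') := by
  induction n generalizing i' k' p r with
  | zero =>
    obtain ⟨rfl, rfl⟩ : i' = i ∧ p = 0 := by omega
    obtain ⟨rfl, rfl⟩ : k' = k ∧ r = 0 := by omega
    exact Run.refl
  | succ n ih =>
    -- The left coordinate after `n` steps, with the weight before and during the last step. The
    -- three cases: its reset is still to come, is the last step, or has already happened.
    obtain ⟨i₁, p₁, p₂, hi₁, hi₂, hp⟩ : ∃ i₁ p₁ p₂, ((i + n ≤ a ∧ i₁ = i + n ∧ p₁ = n) ∨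
        (i ≤ a ∧ a < i + n ∧ i₁ + (a + 1) = i + n ∧ p₁ + 1 = n)) ∧
        ((i₁ = a ∧ i' = 0 ∧ p₂ = 0) ∨ (i₁ ≠ a ∧ i' = i₁ + 1 ∧ p₂ = 1)) ∧ p = p₁ + p₂ := by
      rcases lt_trichotomy (i + n) a with h | h | h
      · exact ⟨i + n, n, 1, by omega⟩
      · exact ⟨i + n, n, 0, by omega⟩
      · exact ⟨i + n - (a + 1), n - 1, 1, by omega⟩
    obtain ⟨k₁, r₁, r₂, hk₁, hk₂, hr⟩ : ∃ k₁ r₁ r₂, ((k + n ≤ a ∧ k₁ = k + n ∧ r₁ = n) ∨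
        (k ≤ a ∧ a < k + n ∧ k₁ + (a + 1) = k + n ∧ r₁ + 1 = n)) ∧
        ((k₁ = a ∧ k' = 0 ∧ r₂ = 0) ∨ (k₁ ≠ a ∧ k' = k₁ + 1 ∧ r₂ = 1)) ∧ r = r₁ + r₂ := by
      rcases lt_trichotomy (k + n) a with h | h | h
      · exact ⟨k + n, n, 1, by omega⟩
      · exact ⟨k + n, n, 0, by omega⟩
      · exact ⟨k + n - (a + 1), n - 1, 1, by omega⟩
    have h₁ := ih (by omega) hi₁ hk₁
    clear ih hi₁ hk₁ hi hk
    have h₂ : Run (step a) (weight a) (resets a) 1 (p₂ + 1 + r₂) (i₁, j + n, k₁)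
        (i', j + (n + 1), k') := by
      apply run_single
      · clear hk₂; omega
      · clear hi₂ hk₂; omega
      · clear hi₂; omega
    -- For `n > 0` the middle coordinate at the junction is at least 2, so the junction is not in
    -- `resets`.
    have h := h₁.trans h₂ (by simp only [resets, Set.mem_ofPred_eq]; omega)
    rwa [show p₁ + n + r₁ + (p₂ + 1 + r₂) = p + (n + 1) + r by omega] at h

/-- The middle coordinate climbs all the way to `a + 1` and resets. Free rotation would advance the
outer coordinates by one; in addition `i = a - 1` skips `a`, because the middle chain is empty, and
`k = 0` skips 1, because its reset happens when the middle chain is full. Each coordinate resets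
once, with a second reset for `i = a - 1` and for `k = a`; this gives the weight. -/
theorem run_large (ha : 2 ≤ a) {i k i' k' : ℕ} (hi : i < a) (hk : k ≤ a) (hk1 : k ≠ 1)
    (hi' : (i + 1 = a ∧ i' = 0) ∨ (i + 1 < a ∧ i' = i + 1))
    (hk' : (k = 0 ∧ k' = 2) ∨ (k = a ∧ k' = 0) ∨ (0 < k ∧ k < a ∧ k' = k + 1)) :
    Run (step a) (weight a) (resets a) (a + 2)
      (3 * a + 3 - (if i + 1 = a then 1 else 0) - (if k = a then 1 else 0)) (i, 0, k)
      (i', 0, k') := by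
  -- The left coordinate after the stages of `1`, `a - 1`, `1` and `1` steps, with its weight on
  -- each stage.
  obtain ⟨i₁, i₂, i₃, p₁, p₂, p₃, p₄, hi₁, hi₂, hi₃, hi₄, hp⟩ : ∃ i₁ i₂ i₃ p₁ p₂ p₃ p₄,
      (((i = a ∨ i + 1 = a) ∧ i₁ = 0 ∧ p₁ = 0) ∨ (¬(i = a ∨ i + 1 = a) ∧ i₁ = i + 1 ∧ p₁ = 1)) ∧
      ((i₁ + (a - 1) ≤ a ∧ i₂ = i₁ + (a - 1) ∧ p₂ = a - 1) ∨
        (i₁ ≤ a ∧ a < i₁ + (a - 1) ∧ i₂ + (a + 1) = i₁ + (a - 1) ∧ p₂ + 1 = a - 1)) ∧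
      ((i₂ = a ∧ i₃ = 0 ∧ p₃ = 0) ∨ (i₂ ≠ a ∧ i₃ = i₂ + 1 ∧ p₃ = 1)) ∧
      ((i₃ = a ∧ i' = 0 ∧ p₄ = 0) ∨ (i₃ ≠ a ∧ i' = i₃ + 1 ∧ p₄ = 1)) ∧
      p₁ + p₂ + p₃ + p₄ + (if i + 1 = a then 1 else 0) = a + 1 := by
    rcases hi' with ⟨h, h'⟩ | ⟨h, h'⟩
    · exact ⟨0, a - 1, a, 0, a - 1, 1, 0, by rw [if_pos h]; omega⟩
    · rw [if_neg h.ne]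
      rcases Nat.eq_zero_or_pos i with h0 | h0
      · exact ⟨1, a, 0, 1, a - 1, 0, 1, by omega⟩
      · exact ⟨i + 1, i - 1, i, 1, a - 2, 1, 1, by omega⟩
  -- The same for the right coordinate. `k₂ ≠ 0` is where `k ≠ 1` enters: with the third chain
  -- empty, the middle coordinate would reset at `a`.
  obtain ⟨k₁, k₂, k₃, r₁, r₂, r₃, r₄, hk₁, hk₂, hk0, hk₃, hk₄, hr⟩ : ∃ k₁ k₂ k₃ r₁ r₂ r₃ r₄,
      ((k = a ∧ k₁ = 0 ∧ r₁ = 0) ∨ (k ≠ a ∧ k₁ = k + 1 ∧ r₁ = 1)) ∧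
      ((k₁ + (a - 1) ≤ a ∧ k₂ = k₁ + (a - 1) ∧ r₂ = a - 1) ∨
        (k₁ ≤ a ∧ a < k₁ + (a - 1) ∧ k₂ + (a + 1) = k₁ + (a - 1) ∧ r₂ + 1 = a - 1)) ∧
      k₂ ≠ 0 ∧ ((k₂ = a ∧ k₃ = 1 ∧ r₃ = 0) ∨ (k₂ ≠ a ∧ k₃ = k₂ + 1 ∧ r₃ = 1)) ∧
      ((k₃ = a ∧ k' = 0 ∧ r₄ = 0) ∨ (k₃ ≠ a ∧ k' = k₃ + 1 ∧ r₄ = 1)) ∧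
      r₁ + r₂ + r₃ + r₄ + (if k = a then 1 else 0) = a + 1 := by
    rcases hk' with ⟨h, h'⟩ | ⟨h, h'⟩ | ⟨h, h', h''⟩
    · exact ⟨1, a, 1, 1, a - 1, 0, 1, by rw [if_neg (by omega)]; omega⟩
    · exact ⟨0, a - 1, a, 0, a - 1, 1, 0, by rw [if_pos h]; omega⟩
    · exact ⟨k + 1, k - 1, k, 1, a - 2, 1, 1, by rw [if_neg (by omega)]; omega⟩
  have h₁ : Run (step a) (weight a) (resets a) 1 (p₁ + 1 + r₁) (i, 0, k) (i₁, 1, k₁) := by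
    apply run_single <;> clear hi₂ hi₃ hi₄ hk₂ hk₃ hk₄ hi' hk' <;> omega
  have h₂ : Run (step a) (weight a) (resets a) (a - 1) (p₂ + (a - 1) + r₂) (i₁, 1, k₁)
      (i₂, 1 + (a - 1), k₂) := by
    apply run_middle <;> clear hi₁ hi₃ hi₄ hk₁ hk₃ hk₄ hi' hk' hp hr <;> omega
  rw [show 1 + (a - 1) = a by omega] at h₂
  have h₃ : Run (step a) (weight a) (resets a) 1 (p₃ + 1 + r₃) (i₂, a, k₂)
      (i₃, a + 1, k₃) := by
    apply run_single <;> clear hi₁ hi₂ hi₄ hk₁ hk₂ hk₄ hi' hk' hp hr <;> omega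
  have h₄ : Run (step a) (weight a) (resets a) 1 (p₄ + 0 + r₄) (i₃, a + 1, k₃) (i', 0, k') := by
    apply run_single <;> clear hi₁ hi₂ hi₃ hk₁ hk₂ hk₃ hp hr <;> omega
  have h := ((h₁.trans h₂ (Or.inr ?_)).trans h₃ (Or.inr ?_)).trans h₄ (Or.inr ?_)
  · convert h using 1
    · omega
    · clear hi₁ hi₂ hi₃ hk₁ hk₂ hk₃ hi₄ hk₄ hi' hk' h₁ h₂ h₃ h₄ h
      omega
  all_goals
    simp only [resets, Set.mem_ofPred_eq]
    clear hi₃ hi₄ hk₁ hk₂ hk₃ hk₄ hi' hk' hp hr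
    omega

/-- Starting from 1, the right coordinate is 0 when the middle one is `a`, which forces the middle
reset one step early. The return time is then the rotation period `a + 1` of the outer coordinates.
-/
theorem run_small_left (ha : 2 ≤ a) {i : ℕ} (hi : i + 2 ≤ a) :
    Run (step a) (weight a) (resets a) (a + 1) (3 * a) (i, 0, 1) (i, 0, 1) := by
  obtain ⟨i₂, p₂, p₃, hi₂, hi₃, hp⟩ : ∃ i₂ p₂ p₃,
      ((i + 1 + (a - 1) ≤ a ∧ i₂ = i + 1 + (a - 1) ∧ p₂ = a - 1) ∨
        (i + 1 ≤ a ∧ a < i + 1 + (a - 1) ∧ i₂ + (a + 1) = i + 1 + (a - 1) ∧ p₂ + 1 = a - 1)) ∧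
      ((i₂ = a ∧ i = 0 ∧ p₃ = 0) ∨ (i₂ ≠ a ∧ i = i₂ + 1 ∧ p₃ = 1)) ∧ 1 + p₂ + p₃ = a := by
    rcases Nat.eq_zero_or_pos i with h0 | h0
    · exact ⟨a, a - 1, 0, by omega⟩
    · exact ⟨i - 1, a - 2, 1, by omega⟩
  have h₁ : Run (step a) (weight a) (resets a) 1 (1 + 1 + 1) (i, 0, 1) (i + 1, 1, 2) := by
    apply run_single <;> clear hi₂ hi₃ hp <;> omega
  have h₂ : Run (step a) (weight a) (resets a) (a - 1) (p₂ + (a - 1) + (a - 2)) (i + 1, 1, 2)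
      (i₂, 1 + (a - 1), 0) := by
    apply run_middle <;> clear hi₃ hp <;> omega
  rw [show 1 + (a - 1) = a by omega] at h₂
  have h₃ : Run (step a) (weight a) (resets a) 1 (p₃ + 0 + 1) (i₂, a, 0) (i, 0, 1) := by
    apply run_single <;> clear hi₂ hp <;> omega
  have h := (h₁.trans h₂ (Or.inr ?_)).trans h₃ (Or.inr ?_)
  · convert h using 1 <;> omega
  all_goals
    simp only [resets, Set.mem_ofPred_eq]
    omega

theorem run_right_middle (ha : 2 ≤ a) {k k₂ r : ℕ}
    (hk : (k + (a - 1) ≤ a ∧ k₂ = k + (a - 1) ∧ r = a - 1) ∨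
      (k ≤ a ∧ a < k + (a - 1) ∧ k₂ + (a + 1) = k + (a - 1) ∧ r + 1 = a - 1)) :
    Run (step a) (weight a) (resets a) (a - 1) (a - 2 + (a - 1) + r) (a, 1, k) (a - 2, a, k₂) := by
  have h : Run (step a) (weight a) (resets a) (a - 1) (a - 2 + (a - 1) + r) (a, 1, k)
      (a - 2, 1 + (a - 1), k₂) := by
    apply run_middle <;> omega
  rwa [show 1 + (a - 1) = a by omega] at h

/-- The middle coordinate resets just when the left one reaches `a`, hence to 1, again after a full
rotation. The right coordinate is neither 0 nor `a` when the middle one is `a`; this fails exactly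
for `k = 2` and `k = 1`. -/
theorem run_small_right (ha : 2 ≤ a) {k : ℕ} (hk : k = 0 ∨ (3 ≤ k ∧ k ≤ a)) :
    Run (step a) (weight a) (resets a) (a + 1) (3 * a) (a, 1, k) (a, 1, k) := by
  obtain ⟨k₂, k₃, r₂, r₃, r₄, hk₂, hk0, hk₃, hk₄, hr⟩ : ∃ k₂ k₃ r₂ r₃ r₄,
      ((k + (a - 1) ≤ a ∧ k₂ = k + (a - 1) ∧ r₂ = a - 1) ∨
        (k ≤ a ∧ a < k + (a - 1) ∧ k₂ + (a + 1) = k + (a - 1) ∧ r₂ + 1 = a - 1)) ∧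
      k₂ ≠ 0 ∧ (k₂ ≠ a ∧ k₃ = k₂ + 1 ∧ r₃ = 1) ∧
      ((k₃ = a ∧ k = 0 ∧ r₄ = 0) ∨ (k₃ ≠ a ∧ k = k₃ + 1 ∧ r₄ = 1)) ∧ r₂ + r₃ + r₄ = a := by
    rcases hk with h | h
    · exact ⟨a - 1, a, a - 1, 1, 0, by omega⟩
    · exact ⟨k - 2, k - 1, a - 2, 1, 1, by omega⟩
  have h₂ := run_right_middle ha hk₂
  have h₃ : Run (step a) (weight a) (resets a) 1 (1 + 1 + r₃) (a - 2, a, k₂)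
      (a - 1, a + 1, k₃) := by
    apply run_single <;> clear hk₂ hk₄ hr <;> omega
  have h₄ : Run (step a) (weight a) (resets a) 1 (1 + 0 + r₄) (a - 1, a + 1, k₃) (a, 1, k) := by
    apply run_single <;> clear hk₂ hk₃ hr <;> omega
  have h := (h₂.trans h₃ (Or.inr ?_)).trans h₄ (Or.inr ?_)
  · convert h using 1 <;> clear hk₂ hk₃ hk₄ hk <;> omega
  all_goals
    simp only [resets, Set.mem_ofPred_eq]
    omega

/-- The right reset coincides with the filling of the middle chain, so it leads to 1 and the right
coordinate gains one. -/
theorem run_medium₁ (ha : 2 ≤ a) :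
    Run (step a) (weight a) (resets a) (a + 1) (3 * a) (a, 1, 1) (a, 1, 2) := by
  have h₂ := run_right_middle ha (k := 1) (k₂ := a) (r := a - 1) (by omega)
  have h₃ : Run (step a) (weight a) (resets a) 1 (1 + 1 + 0) (a - 2, a, a) (a - 1, a + 1, 1) := by
    apply run_single <;> omega
  have h₄ : Run (step a) (weight a) (resets a) 1 (1 + 0 + 1) (a - 1, a + 1, 1) (a, 1, 2) := by
    apply run_single <;> omega
  have h := (h₂.trans h₃ (Or.inr ?_)).trans h₄ (Or.inr ?_)
  · convert h using 1 <;> omega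
  all_goals
    simp only [resets, Set.mem_ofPred_eq]
    omega

/-- The right coordinate is 0 when the middle one is `a`, so the middle reset comes one step early,
while the left coordinate is only reaching `a - 1`. -/
theorem run_medium₂ (ha : 2 ≤ a) :
    Run (step a) (weight a) (resets a) a (3 * a - 3) (a, 1, 2) (a - 1, 0, 1) := by
  have h₂ := run_right_middle ha (k := 2) (k₂ := 0) (r := a - 2) (by omega)
  have h₃ : Run (step a) (weight a) (resets a) 1 (1 + 0 + 1) (a - 2, a, 0) (a - 1, 0, 1) := by
    apply run_single <;> omega
  have h := h₂.trans h₃ (Or.inr ?_)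
  · convert h using 1 <;> omega
  all_goals
    simp only [resets, Set.mem_ofPred_eq]
    omega

/-- The left coordinate skips `a` at the start and so reaches `a` at the early reset of the middle
one, which therefore restarts at 1. -/
theorem run_medium₃ (ha : 2 ≤ a) :
    Run (step a) (weight a) (resets a) (a + 1) (3 * a) (a - 1, 0, 1) (a, 1, 1) := by
  have h₁ : Run (step a) (weight a) (resets a) 1 (0 + 1 + 1) (a - 1, 0, 1) (0, 1, 2) := by
    apply run_single <;> omega
  have h₂ : Run (step a) (weight a) (resets a) (a - 1) (a - 1 + (a - 1) + (a - 2)) (0, 1, 2)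
      (a - 1, 1 + (a - 1), 0) := by
    apply run_middle <;> omega
  rw [show 1 + (a - 1) = a by omega] at h₂
  have h₃ : Run (step a) (weight a) (resets a) 1 (1 + 0 + 1) (a - 1, a, 0) (a, 1, 1) := by
    apply run_single <;> omega
  have h := (h₁.trans h₂ (Or.inr ?_)).trans h₃ (Or.inr ?_)
  · convert h using 1 <;> omega
  all_goals
    simp only [resets, Set.mem_ofPred_eq]
    omega

end Step
/-! ### The orbits in coordinates -/

/-- Labels of the orbits: the small ones in dual pairs, the medium one, the large ones. -/
abbrev OrbitLabel (a : ℕ) : Type := (Fin (a - 1) × Bool) ⊕ (Unit ⊕ Fin a)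

/-- The element with number `v` of the cycle `0, 2, 3, …, a`. -/
def cyc (v : ℕ) : ℕ := if v = 0 then 0 else v + 1

/-- A representative of each orbit. -/
def rep (a : ℕ) : OrbitLabel a → ℕ × ℕ × ℕ
  | .inl (n, false) => (n, 0, 1)
  | .inl (n, true) => (a, 1, if n.1 = 0 then 0 else a + 1 - n)
  | .inr (.inl _) => (a, 1, 1)
  | .inr (.inr v) => (0, 0, cyc v)

/-- The sizes of the orbits. -/
def size (a : ℕ) : OrbitLabel a → ℕ
  | .inl _ => a + 1
  | .inr (.inl _) => 3 * a + 2
  | .inr (.inr _) => a ^ 2 + 2 * a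

/-- The values of the antichain cardinality statistic on the orbits. -/
def total (a : ℕ) : OrbitLabel a → ℕ
  | .inl _ => 3 * a
  | .inr (.inl _) => 9 * a - 3
  | .inr (.inr _) => 3 * a ^ 2 + 3 * a - 2

/-- The effect of the ideal complement on orbits. -/
def dual (a : ℕ) : OrbitLabel a → OrbitLabel a
  | .inl (n, b) => .inl (n, !b)
  | .inr o => .inr o

variable {a : ℕ}

theorem dual_dual (o : OrbitLabel a) : dual a (dual a o) = o := by
  rcases o with ⟨n, b⟩ | o <;> simp [dual]

/-! ### Closing up the returns into orbits -/

theorem cyc_spec (v : ℕ) : (v = 0 ∧ cyc v = 0) ∨ (0 < v ∧ cyc v = v + 1) := by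
  unfold cyc
  split_ifs <;> omega

theorem exists_cyc_eq (ha : 2 ≤ a) {k : ℕ} (hk : k ≤ a) (hk1 : k ≠ 1) : ∃ v < a, k = cyc v := by
  rcases Nat.eq_zero_or_pos k with h | h
  · exact ⟨0, by omega, by simp [cyc, h]⟩
  · exact ⟨k - 1, by omega, by have := cyc_spec (k - 1); omega⟩

theorem rep_valid (ha : 2 ≤ a) (o : OrbitLabel a) : Valid a (rep a o) := by
  rcases o with ⟨n, _ | _⟩ | _ | v <;> simp only [rep, Valid]
  · omega
  · split_ifs <;> omega
  · omega
  · have := cyc_spec v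
    omega

theorem rep_injective (ha : 2 ≤ a) : Function.Injective (rep a) := by
  rintro (⟨n, _ | _⟩ | _ | v) (⟨m, _ | _⟩ | _ | w) h <;>
    simp only [rep, Prod.mk.injEq] at h <;> try omega
  · obtain rfl : n = m := Fin.ext h.1
    rfl
  · have := cyc_spec w
    omega
  · obtain rfl : n = m := by
      ext
      have h := h.2.2
      split_ifs at h <;> omega
    rfl
  · have h := h.2.2
    split_ifs at h
    omega
  · have h := h.2.2
    split_ifs at h
    omega
  · rfl
  · have := cyc_spec v
    omega
  · obtain rfl : v = w := by
      ext
      have := cyc_spec v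
      have := cyc_spec w
      omega
    rfl

theorem range_rep_subset : Set.range (rep a) ⊆ resets a := by
  rintro _ ⟨⟨n, _ | _⟩ | _ | v, rfl⟩ <;> simp [rep, resets]

theorem notMem_range_rep (ha : 2 ≤ a) {i k : ℕ} (hi : 0 < i) (h : k ≠ 1 ∨ i + 1 = a) :
    (i, 0, k) ∉ Set.range (rep a) := by
  rintro ⟨⟨n, _ | _⟩ | _ | v, h'⟩ <;> simp only [rep, Prod.mk.injEq] at h' <;> omega

/-- After `q` returns the index on the right cycle is `v + q` modulo `a`. One unit of weight is lost
if it has wrapped around; the left coordinate, being `q < a`, has not wrapped yet. -/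
theorem run_large_rep (ha : 2 ≤ a) {v q : ℕ} (hv : v < a) (hq : q < a) :
    ∃ w c, w < a ∧ ((v + q < a ∧ w = v + q ∧ c = q * (3 * a + 3)) ∨
      (a ≤ v + q ∧ w + a = v + q ∧ c + 1 = q * (3 * a + 3))) ∧
      Run (step a) (weight a) (Set.range (rep a)) (q * (a + 2)) c (0, 0, cyc v) (q, 0, cyc w) := by
  induction q with
  | zero => exact ⟨v, 0, hv, by omega, by simpa using Run.refl⟩
  | succ q ih =>
    obtain ⟨w, c, hw, h, hrun⟩ := ih (by omega)
    have hcw := cyc_spec w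
    obtain ⟨w', hw', hww⟩ : ∃ w' < a, (w + 1 < a ∧ w' = w + 1) ∨ (w + 1 = a ∧ w' = 0) := by
      by_cases hwa : w + 1 < a
      · exact ⟨w + 1, hwa, by omega⟩
      · exact ⟨0, by omega, by omega⟩
    have hcw' := cyc_spec w'
    have h1 := (run_large (i := q) (k := cyc w) (i' := q + 1) (k' := cyc w') ha (by omega)
      (by omega) (by omega) (by omega) (by omega)).mono range_rep_subset
    have h2 := hrun.trans h1 (by
      rcases Nat.eq_zero_or_pos q with h0 | h0
      · exact Or.inl (by simp [h0])
      · exact Or.inr (notMem_range_rep ha h0 (by omega)))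
    rw [if_neg (show q + 1 ≠ a by omega)] at h2
    refine ⟨w', _, hw', ?_, by rwa [Nat.add_one_mul]⟩
    rw [Nat.add_one_mul q (3 * a + 3)]
    generalize q * (3 * a + 3) = z at h ⊢
    split_ifs <;> omega

theorem run_rep (ha : 2 ≤ a) (o : OrbitLabel a) :
    Run (step a) (weight a) (Set.range (rep a)) (size a o) (total a o) (rep a o) (rep a o) := by
  rcases o with ⟨n, _ | _⟩ | _ | v
  · exact (run_small_left ha (by omega)).mono range_rep_subset
  · refine (run_small_right ha ?_).mono range_rep_subset
    split_ifs <;> omega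
  · have h := (((run_medium₁ ha).mono range_rep_subset).trans
      ((run_medium₂ ha).mono range_rep_subset) (Or.inr ?_)).trans
      ((run_medium₃ ha).mono range_rep_subset)
      (Or.inr (notMem_range_rep ha (by omega) (by omega)))
    · convert h using 1
      · simp only [size]; omega
      · simp only [total]; omega
      · rfl
      · rfl
    · rintro ⟨⟨n, _ | _⟩ | _ | v, h'⟩ <;> simp only [rep, Prod.mk.injEq] at h'
      · omega
      · obtain ⟨-, -, h'⟩ := h'
        split_ifs at h' <;> omega
      · omega
      · omega
  · obtain ⟨w, c, hw, h, hrun⟩ := run_large_rep ha v.2 (show a - 1 < a by omega)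
    have hcw := cyc_spec w
    have hcv := cyc_spec v
    -- The last return wraps the left coordinate. The right index wraps once in all: in this return
    -- if `v = 0`, and otherwise earlier, where `c` accounts for it.
    have h1 := (run_large (i := a - 1) (k := cyc w) (i' := 0) (k' := cyc v) ha (by omega)
      (by omega) (by omega) (by omega) (by omega)).mono range_rep_subset
    have h2 := hrun.trans h1 (Or.inr (notMem_range_rep ha (by omega) (by omega)))
    rw [if_pos (show a - 1 + 1 = a by omega)] at h2
    obtain ⟨b, rfl⟩ : ∃ b, a = b + 2 := ⟨a - 2, by omega⟩
    convert h2 using 1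
    · simp only [size]
      rw [show b + 2 - 1 = b + 1 by omega]
      ring
    · simp only [total]
      have e : (b + 2 - 1) * (3 * (b + 2) + 3) = 3 * (b + 2) ^ 2 - 3 := by
        rw [show b + 2 - 1 = b + 1 by omega]
        zify [show 3 ≤ 3 * (b + 2) ^ 2 by nlinarith]
        ring
      have e' : 4 ≤ (b + 2) ^ 2 := by nlinarith
      rw [e] at h
      generalize (b + 2) ^ 2 = z at *
      split_ifs <;> omega
    · rfl
    · rfl

/-- The middle coordinate is bounded by `a + 1` and grows at every step that does not reset it. -/
theorem exists_iterate_mem_resets {s : ℕ × ℕ × ℕ} (ha : 2 ≤ a) (hs : Valid a s) :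
    ∃ n, (step a)^[n] s ∈ resets a ∧ Valid a ((step a)^[n] s) := by
  obtain ⟨d, hd⟩ : ∃ d, a + 2 = s.2.1 + d := ⟨a + 2 - s.2.1, by have := hs.2.1; omega⟩
  induction d generalizing s with
  | zero => have := hs.2.1; omega
  | succ d ih =>
    obtain ⟨i, j, k⟩ := s
    obtain ⟨i', j', k', h, hi, hj, hk⟩ := exists_step_eq a i j k
    have hs' := hs.step ha
    rcases hj with ⟨-, hj⟩ | ⟨-, hj⟩
    · refine ⟨1, ?_, hs'⟩
      rw [Function.iterate_one, h]
      simp only [resets, Set.mem_ofPred_eq]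
      omega
    · obtain ⟨n, hn⟩ := ih hs' (by rw [h]; dsimp only at hd ⊢; omega)
      exact ⟨n + 1, hn⟩

/-- Going back `i` returns subtracts `i` from the index of `k` modulo `a`. The clause on `k = 0`
serves to identify the orbit of a complement. -/
theorem exists_iterate_large (ha : 2 ≤ a) {i k : ℕ} (hi : i < a) (hk : k ≤ a) (hk1 : k ≠ 1) :
    ∃ v : Fin a, (k = 0 → i + v = a ∨ (i = 0 ∧ v.1 = 0)) ∧
      ∃ n, (step a)^[n] (rep a (.inr (.inr v))) = (i, 0, k) := by
  obtain ⟨w, hw, rfl⟩ := exists_cyc_eq ha hk hk1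
  obtain ⟨v, hv, hvw⟩ : ∃ v < a, v + i = w ∨ v + i = w + a := by
    rcases Nat.lt_or_ge w i with h | h
    · exact ⟨w + a - i, by omega, by omega⟩
    · exact ⟨w - i, by omega, by omega⟩
  obtain ⟨w', c, hw', h, hrun⟩ := run_large_rep ha hv hi
  obtain rfl : w' = w := by omega
  refine ⟨⟨v, hv⟩, fun h0 => ?_, _, hrun.iter⟩
  have := cyc_spec w'
  dsimp only
  omega

/-- Every triple lies on the orbit of a representative. -/
theorem exists_iterate_rep (ha : 2 ≤ a) {s : ℕ × ℕ × ℕ} (hs : Valid a s) :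
    ∃ o n m, (step a)^[n] s = (step a)^[m] (rep a o) := by
  obtain ⟨n, hn, hv⟩ := exists_iterate_mem_resets ha hs
  generalize ht : (step a)^[n] s = t at hn hv
  suffices h : ∃ o m n', (step a)^[n'] t = (step a)^[m] (rep a o) by
    obtain ⟨o, m, n', h⟩ := h
    exact ⟨o, n' + n, m, by rw [Function.iterate_add_apply, ht, h]⟩
  obtain ⟨i, j, k⟩ := t
  simp only [resets, Set.mem_ofPred_eq, Valid] at hn hv
  rcases hn with rfl | ⟨rfl, rfl⟩
  · rcases eq_or_ne k 1 with rfl | hk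
    · rcases Nat.lt_or_ge i (a - 1) with h | h
      · exact ⟨.inl (⟨i, h⟩, false), 0, 0, rfl⟩
      · obtain rfl : i = a - 1 := by omega
        exact ⟨.inr (.inl ()), 0, _, (run_medium₃ ha).iter⟩
    · obtain ⟨v, -, n, hn⟩ := exists_iterate_large ha (i := i) (k := k) (by omega) (by omega) hk
      exact ⟨_, n, 0, hn.symm⟩
  · rcases eq_or_ne k 1 with rfl | h1
    · exact ⟨.inr (.inl ()), 0, 0, rfl⟩
    rcases eq_or_ne k 2 with rfl | h2
    · exact ⟨.inr (.inl ()), _, 0, (run_medium₁ ha).iter.symm⟩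
    rcases Nat.eq_zero_or_pos k with rfl | h
    · exact ⟨.inl (⟨0, by omega⟩, true), 0, 0, by simp [rep]⟩
    -- Here `i` stands for `a`, and the label inverts `k = a + 1 - n`.
    · refine ⟨.inl (⟨i + 1 - k, by omega⟩, true), 0, 0, ?_⟩
      simp only [rep, Function.iterate_zero, id_eq, Prod.mk.injEq, true_and]
      split_ifs <;> omega

/-- One step after the complement, a small representative becomes its partner (the second family in
`rep` is chosen for this), the medium one returns to itself, and a large one becomes `(i, 0, 0)`
with `i + v` divisible by `a`, a point of its own orbit. -/
theorem exists_iterate_comp_rep (ha : 2 ≤ a) (o : OrbitLabel a) :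
    ∃ n m, (step a)^[n] (comp a (rep a o)) = (step a)^[m] (rep a (dual a o)) := by
  rcases o with ⟨n, _ | _⟩ | _ | v
  · refine ⟨1, 0, ?_⟩
    simp only [rep, dual, comp, Bool.not_false, Function.iterate_one, Function.iterate_zero, id_eq]
    apply step_eq
    · omega
    · omega
    · split_ifs <;> omega
  · refine ⟨1, 0, ?_⟩
    simp only [rep, dual, comp, Bool.not_true, Function.iterate_one, Function.iterate_zero, id_eq]
    apply step_eq
    · split_ifs <;> omega
    · omega
    · omega
  · refine ⟨1, 0, ?_⟩
    simp only [rep, dual, comp, Function.iterate_one, Function.iterate_zero, id_eq]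
    apply step_eq <;> omega
  · have hc := cyc_spec v
    obtain ⟨i, hi, hiv⟩ : ∃ i < a, i + v = a ∨ (i = 0 ∧ v.1 = 0) := by
      rcases Nat.eq_zero_or_pos v with h | h
      · exact ⟨0, by omega, by omega⟩
      · exact ⟨a - v, by omega, by omega⟩
    obtain ⟨w, hw, n, hn⟩ := exists_iterate_large ha hi (Nat.zero_le a) zero_ne_one
    obtain rfl : w = v := by
      ext
      have := hw rfl
      omega
    refine ⟨1, n, ?_⟩
    simp only [dual]
    rw [hn]
    simp only [rep, comp, Function.iterate_one]
    apply step_eq <;> omega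

/-! ### The fence -/

/-- The fence with three chains of `a`, `a + 1` and `a` elements. -/
abbrev TripleFence (a : ℕ) : Type := Fence [a, 1, a, 1, a]

section Order

variable {a : ℕ}

theorem fenceStepUp_eq_false_iff {j : ℕ} (hj : j < 3 * a + 2) :
    fenceStepUp [a, 1, a, 1, a] j = false ↔ j = a ∨ j = 2 * a + 1 := by
  simp only [fenceStepUp]
  split_ifs <;> simp <;> omega

theorem fenceStepUp_eq_true_iff {j : ℕ} (hj : j < 3 * a + 2) :
    fenceStepUp [a, 1, a, 1, a] j = true ↔ j ≠ a ∧ j ≠ 2 * a + 1 := by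
  rw [← not_iff_not, Bool.not_eq_true, fenceStepUp_eq_false_iff hj]
  omega

theorem pos_lt (x : TripleFence a) : x.pos < 3 * a + 1 := by
  have h : x.pos < [a, 1, a, 1, a].sum - 1 := Fin.is_lt x
  simp only [List.sum_cons, List.sum_nil] at h
  omega

theorem exists_pos_eq {p : ℕ} (hp : p < 3 * a + 1) : ∃ x : TripleFence a, x.pos = p :=
  ⟨(⟨p, by simp only [List.sum_cons, List.sum_nil]; omega⟩ : Fin ([a, 1, a, 1, a].sum - 1)), rfl⟩

theorem le_iff (ha : 2 ≤ a) {x y : TripleFence a} : x ≤ y ↔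
    (x.pos ≤ y.pos ∧ (y.pos < a ∨ (a ≤ x.pos ∧ y.pos < 2 * a + 1) ∨ 2 * a + 1 ≤ x.pos)) ∨
    (x.pos = a ∧ y.pos + 1 = a) ∨ (x.pos = 2 * a + 1 ∧ y.pos = 2 * a) := by
  have hx := pos_lt x
  have hy := pos_lt y
  constructor
  · rintro (⟨h1, h2⟩ | ⟨h1, h2⟩)
    -- The only two descending steps, which an ascending path must avoid.
    · have e1 := h2 (a - 1)
      have e2 := h2 (2 * a)
      rw [fenceStepUp_eq_true_iff (by omega)] at e1 e2
      omega
    · rcases h1.eq_or_lt with h | h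
      · omega
      have e1 := (fenceStepUp_eq_false_iff (by omega)).1 (h2 y.pos le_rfl h)
      -- The two descending steps are not consecutive, so a descending path has length at most one.
      rcases Nat.lt_or_ge (y.pos + 1) x.pos with h' | h'
      · have e2 := (fenceStepUp_eq_false_iff (by omega)).1 (h2 (y.pos + 1) (by omega) h')
        omega
      · omega
  · rintro (⟨h1, h2⟩ | h | h)
    · refine Or.inl ⟨h1, fun k hk hk' => (fenceStepUp_eq_true_iff (by omega)).2 (by omega)⟩
    · refine Or.inr ⟨by omega, fun k hk hk' => (fenceStepUp_eq_false_iff (by omega)).2 (by omega)⟩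
    · refine Or.inr ⟨by omega, fun k hk hk' => (fenceStepUp_eq_false_iff (by omega)).2 (by omega)⟩

/-- The ideal with `s.1`, `s.2.1` and `s.2.2` elements on the three chains, for valid `s`. -/
def ideal (a : ℕ) (s : ℕ × ℕ × ℕ) : LowerSet (TripleFence a) :=
  lowerClosure {x | x.pos < s.1 ∨ (a ≤ x.pos ∧ x.pos < a + s.2.1) ∨
    (2 * a + 1 ≤ x.pos ∧ x.pos < 2 * a + 1 + s.2.2)}

/-- Validity says that the three initial segments respect the two relations between chains, so the
lower closure adds nothing. -/
theorem mem_ideal (ha : 2 ≤ a) {s : ℕ × ℕ × ℕ} (hs : Valid a s) {x : TripleFence a} :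
    x ∈ ideal a s ↔ x.pos < s.1 ∨ (a ≤ x.pos ∧ x.pos < a + s.2.1) ∨
      (2 * a + 1 ≤ x.pos ∧ x.pos < 2 * a + 1 + s.2.2) := by
  refine ⟨?_, fun h => subset_lowerClosure h⟩
  rintro ⟨y, hy, hxy⟩
  obtain ⟨i, j, k⟩ := s
  rw [le_iff ha] at hxy
  simp only [Set.mem_ofPred_eq, Valid] at hy hs ⊢
  omega

theorem ideal_injOn (ha : 2 ≤ a) {s t : ℕ × ℕ × ℕ} (hs : Valid a s) (ht : Valid a t)
    (h : ideal a s = ideal a t) : s = t := by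
  have key : ∀ p, p < 3 * a + 1 →
      ((p < s.1 ∨ (a ≤ p ∧ p < a + s.2.1) ∨ (2 * a + 1 ≤ p ∧ p < 2 * a + 1 + s.2.2)) ↔
       (p < t.1 ∨ (a ≤ p ∧ p < a + t.2.1) ∨ (2 * a + 1 ≤ p ∧ p < 2 * a + 1 + t.2.2))) := by
    intro p hp
    obtain ⟨x, rfl⟩ := exists_pos_eq hp
    rw [← mem_ideal ha hs, ← mem_ideal ha ht, h]
  obtain ⟨i, j, k⟩ := s
  obtain ⟨i', j', k'⟩ := t
  simp only [Valid] at hs ht key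
  have e1 := key i
  have e2 := key i'
  have e3 := key (a + j)
  have e4 := key (a + j')
  have e5 := key (2 * a + 1 + k)
  have e6 := key (2 * a + 1 + k')
  clear key
  simp only [Prod.mk.injEq]
  refine ⟨?_, ?_, ?_⟩
  · clear e3 e4 e5 e6; omega
  · clear e1 e2 e5 e6; omega
  · clear e1 e2 e3 e4; omega

/-- A downward closed predicate on an initial segment is a threshold. -/
theorem exists_threshold (P : ℕ → Prop) (n : ℕ) (h : ∀ p, p + 1 < n → P (p + 1) → P p) :
    ∃ i ≤ n, ∀ p < n, P p ↔ p < i := by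
  induction n with
  | zero => exact ⟨0, le_rfl, by simp⟩
  | succ n ih =>
    obtain ⟨i, hi, hP⟩ := ih fun p hp => h p (by omega)
    by_cases hn : P n
    · refine ⟨n + 1, le_rfl, fun p hp => ⟨fun _ => hp, fun _ => ?_⟩⟩
      rcases Nat.lt_or_ge p n with hpn | hpn
      · have : n - 1 < i := by
          rw [← hP (n - 1) (by omega)]
          refine h (n - 1) (by omega) ?_
          rwa [Nat.sub_add_cancel (by omega)]
        exact (hP p hpn).2 (by omega)
      · obtain rfl : p = n := by omega
        exact hn
    · refine ⟨i, by omega, fun p hp => ?_⟩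
      rcases Nat.lt_or_ge p n with hpn | hpn
      · exact hP p hpn
      · obtain rfl : p = n := by omega
        exact ⟨fun h => absurd h hn, fun h => by omega⟩

/-- An ideal meets each chain in an initial segment, and the two relations between chains give
validity. -/
theorem exists_ideal_eq (ha : 2 ≤ a) (I : LowerSet (TripleFence a)) :
    ∃ s, Valid a s ∧ ideal a s = I := by
  have lower : ∀ {p q : ℕ}, (∃ x ∈ I, x.pos = q) → p < 3 * a + 1 →
      ((p ≤ q ∧ (q < a ∨ (a ≤ p ∧ q < 2 * a + 1) ∨ 2 * a + 1 ≤ p)) ∨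
      (p = a ∧ q + 1 = a) ∨ (p = 2 * a + 1 ∧ q = 2 * a)) → ∃ x ∈ I, x.pos = p := by
    rintro p q ⟨x, hx, rfl⟩ hp h
    obtain ⟨y, rfl⟩ := exists_pos_eq hp
    exact ⟨y, I.lower ((le_iff ha).2 h) hx, rfl⟩
  obtain ⟨i, hi, h1⟩ := exists_threshold (fun p => ∃ x ∈ I, x.pos = p) a
    fun p hp h => lower h (by omega) (by omega)
  obtain ⟨j, hj, h2⟩ := exists_threshold (fun p => ∃ x ∈ I, x.pos = a + p) (a + 1)
    fun p hp h => lower h (by omega) (by omega)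
  obtain ⟨k, hk, h3⟩ := exists_threshold (fun p => ∃ x ∈ I, x.pos = 2 * a + 1 + p) a
    fun p hp h => lower h (by omega) (by omega)
  have hv : Valid a (i, j, k) := by
    refine ⟨hi, hj, hk, fun h => ?_, fun h => ?_⟩
    · exact (h2 0 (by omega)).1 (lower ((h1 (a - 1) (by omega)).2 (by dsimp only at h; omega))
        (by omega) (by omega))
    · exact (h3 0 (by omega)).1 (lower ((h2 a (by omega)).2 (by dsimp only at h; omega))
        (by omega) (by omega))
  refine ⟨(i, j, k), hv, ?_⟩
  ext x
  rw [SetLike.mem_coe, SetLike.mem_coe, mem_ideal ha hv]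
  have hx := pos_lt x
  have hI : ∀ q, q = x.pos → ((∃ y ∈ I, y.pos = q) ↔ x ∈ I) := by
    rintro _ rfl
    exact ⟨fun ⟨y, hy, hyx⟩ => Fence.pos_injective hyx ▸ hy, fun h => ⟨x, h, rfl⟩⟩
  dsimp only
  rcases Nat.lt_or_ge x.pos a with h | h
  · rw [← hI _ rfl, h1 _ h]
    omega
  · rcases Nat.lt_or_ge x.pos (2 * a + 1) with h' | h'
    · rw [← hI (a + (x.pos - a)) (by omega), h2 _ (by omega)]
      omega
    · rw [← hI (2 * a + 1 + (x.pos - (2 * a + 1))) (by omega), h3 _ (by omega)]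
      omega

theorem minimal_compl_iff (ha : 2 ≤ a) {s : ℕ × ℕ × ℕ} (hs : Valid a s) {x : TripleFence a} :
    Minimal (· ∈ (ideal a s).compl) x ↔
      (x.pos = s.1 ∧ ¬(s.1 = a ∨ (s.1 + 1 = a ∧ s.2.1 = 0))) ∨
      (x.pos = a + s.2.1 ∧ ¬(s.2.1 = a + 1 ∨ (s.2.1 = a ∧ s.2.2 = 0))) ∨
      (x.pos = 2 * a + 1 + s.2.2 ∧ s.2.2 ≠ a) := by
  have hx := pos_lt x
  simp only [Minimal, LowerSet.mem_compl_iff, mem_ideal ha hs]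
  obtain ⟨i, j, k⟩ := s
  simp only [Valid] at hs ⊢
  constructor
  · rintro ⟨h, hmin⟩
    have key : ∀ p, p < 3 * a + 1 →
        ((p ≤ x.pos ∧ (x.pos < a ∨ (a ≤ p ∧ x.pos < 2 * a + 1) ∨ 2 * a + 1 ≤ p)) ∨
          (p = a ∧ x.pos + 1 = a) ∨ (p = 2 * a + 1 ∧ x.pos = 2 * a)) → p ≠ x.pos →
        p < i ∨ (a ≤ p ∧ p < a + j) ∨ (2 * a + 1 ≤ p ∧ p < 2 * a + 1 + k) := by
      intro p hp hpx hne
      obtain ⟨y, rfl⟩ := exists_pos_eq hp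
      by_contra hy
      have hyx := (le_iff ha).2 hpx
      exact hne (congrArg _ (le_antisymm hyx (hmin hy hyx)))
    clear hmin
    rcases Nat.lt_or_ge x.pos a with h1 | h1
    · have e1 := key (x.pos - 1) (by omega) (by omega)
      have e2 := key a (by omega)
      clear key
      omega
    rcases Nat.lt_or_ge x.pos (2 * a + 1) with h2 | h2
    · rcases h1.eq_or_lt with h1 | h1
      · clear key; omega
      have e1 := key (x.pos - 1) (by omega) (by omega)
      have e2 := key (2 * a + 1) (by omega)
      clear key
      omega
    · rcases h2.eq_or_lt with h2 | h2
      · clear key; omega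
      have e1 := key (x.pos - 1) (by omega) (by omega)
      clear key
      omega
  · intro h
    refine ⟨by omega, fun y hy hyx => ?_⟩
    have := pos_lt y
    rw [le_iff ha] at hyx ⊢
    omega

end Order

/-! ### Rowmotion on the fence -/

section Rowmotion

variable {a : ℕ}

/-- This identifies `step` with rowmotion: a chain with a new generator grows by one, and a chain
without one keeps at most its bottom, when the top of its left neighbour is a new generator. -/
theorem exists_minimal_compl_iff (ha : 2 ≤ a) {s : ℕ × ℕ × ℕ} (hs : Valid a s)
    {x : TripleFence a} :
    (∃ y, Minimal (· ∈ (ideal a s).compl) y ∧ x ≤ y) ↔ x ∈ ideal a (step a s) := by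
  rw [mem_ideal ha (hs.step ha)]
  have hx := pos_lt x
  simp only [minimal_compl_iff ha hs, le_iff ha]
  obtain ⟨i, j, k⟩ := s
  obtain ⟨i', j', k', h, hi, hj, hk⟩ := exists_step_eq a i j k
  rw [h]
  simp only [Valid] at hs ⊢
  constructor
  · rintro ⟨y, hy, hxy⟩
    have := pos_lt y
    rcases hy with hy | hy | hy
    · clear hk; omega
    · clear hi; omega
    · clear hi; omega
  · intro hxs
    suffices h : ∃ p < 3 * a + 1, ((p = i ∧ ¬(i = a ∨ (i + 1 = a ∧ j = 0))) ∨
        (p = a + j ∧ ¬(j = a + 1 ∨ (j = a ∧ k = 0))) ∨ (p = 2 * a + 1 + k ∧ k ≠ a)) ∧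
        ((x.pos ≤ p ∧ (p < a ∨ (a ≤ x.pos ∧ p < 2 * a + 1) ∨ 2 * a + 1 ≤ x.pos)) ∨
        (x.pos = a ∧ p + 1 = a) ∨ (x.pos = 2 * a + 1 ∧ p = 2 * a)) by
      obtain ⟨p, hp, h⟩ := h
      obtain ⟨y, rfl⟩ := exists_pos_eq hp
      exact ⟨y, h⟩
    rcases hxs with hxs | hxs | hxs
    · clear hj hk
      exact ⟨i, by omega⟩
    · clear hk
      rcases hj with hj | hj
      · exact ⟨i, by omega⟩
      · clear hi
        exact ⟨a + j, by omega⟩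
    · clear hi
      rcases hk with hk | hk
      · exact ⟨a + j, by omega⟩
      · clear hj
        exact ⟨2 * a + 1 + k, by omega⟩

theorem idealRowmotion_ideal (ha : 2 ≤ a) {s : ℕ × ℕ × ℕ} (hs : Valid a s) :
    idealRowmotion (TripleFence a) (ideal a s) = ideal a (step a s) := by
  ext x
  rw [SetLike.mem_coe, SetLike.mem_coe, ← exists_minimal_compl_iff ha hs]
  rfl

/-- The antichain of minimal elements of the complement of an ideal. -/
def antichain (a : ℕ) (s : ℕ × ℕ × ℕ) : Antichains (TripleFence a) :=
  filterToAntichain _ (complEquiv _ (ideal a s))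

theorem idealToAntichain_symm_antichain (ha : 2 ≤ a) {s : ℕ × ℕ × ℕ} (hs : Valid a s) :
    (idealToAntichain (TripleFence a)).symm (antichain a s) = ideal a (step a s) :=
  idealRowmotion_ideal ha hs

theorem rowmotion_antichain (ha : 2 ≤ a) {s : ℕ × ℕ × ℕ} (hs : Valid a s) :
    rowmotion (TripleFence a) (antichain a s) = antichain a (step a s) := by
  change filterToAntichain _ (complEquiv _ ((idealToAntichain (TripleFence a)).symm _)) = _
  rw [idealToAntichain_symm_antichain ha hs, antichain]

theorem antichain_injOn (ha : 2 ≤ a) {s t : ℕ × ℕ × ℕ} (hs : Valid a s) (ht : Valid a t)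
    (h : antichain a s = antichain a t) : s = t :=
  ideal_injOn ha hs ht ((complEquiv _).injective ((filterToAntichain _).injective h))

theorem exists_antichain_eq (ha : 2 ≤ a) (A : Antichains (TripleFence a)) :
    ∃ s, Valid a s ∧ antichain a s = A := by
  obtain ⟨s, hs, h⟩ :=
    exists_ideal_eq ha ((complEquiv _).symm ((filterToAntichain (TripleFence a)).symm A))
  exact ⟨s, hs, by simp [antichain, h]⟩

theorem chi_antichain (ha : 2 ≤ a) {s : ℕ × ℕ × ℕ} (hs : Valid a s) :
    chi (antichain a s) = weight a s := by
  have himage : Fence.pos '' (antichain a s).1 =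
      (((if s.1 = a ∨ (s.1 + 1 = a ∧ s.2.1 = 0) then ∅ else {s.1}) ∪
      (if s.2.1 = a + 1 ∨ (s.2.1 = a ∧ s.2.2 = 0) then ∅ else {a + s.2.1}) ∪
      (if s.2.2 = a then ∅ else {2 * a + 1 + s.2.2}) : Finset ℕ) : Set ℕ) := by
    ext p
    have h : p ∈ Fence.pos '' (antichain a s).1 ↔
        ∃ x, Minimal (· ∈ (ideal a s).compl) x ∧ x.pos = p := Iff.rfl
    simp only [h, minimal_compl_iff ha hs]
    have hp : ∀ c : Prop, ∀ [Decidable c], ∀ q, p ∈ (if c then (∅ : Finset ℕ) else {q}) ↔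
        (p = q ∧ ¬ c) := by
      intro c _ q
      split_ifs with hc <;> simp [hc]
    rw [Finset.mem_coe, Finset.mem_union, Finset.mem_union, hp, hp, hp, or_assoc]
    constructor
    · rintro ⟨x, hx, rfl⟩
      exact hx
    · intro h
      obtain ⟨x, rfl⟩ : ∃ x : TripleFence a, x.pos = p := by
        apply exists_pos_eq
        simp only [Valid] at hs
        omega
      exact ⟨x, h, rfl⟩
  have hcard : ∀ c : Prop, ∀ [Decidable c], ∀ q : ℕ, (if c then (∅ : Finset ℕ) else {q}).card =
      if c then 0 else 1 := by
    intro c _ q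
    split_ifs <;> rfl
  have hmem : ∀ c : Prop, ∀ [Decidable c], ∀ p q : ℕ,
      p ∈ (if c then (∅ : Finset ℕ) else {q}) → p = q ∧ ¬ c := by
    intro c _ p q
    split_ifs with hc <;> simp [hc]
  rw [chi, ← Set.ncard_image_of_injective _ Fence.pos_injective, himage, Set.ncard_coe_finset,
    Finset.card_union_of_disjoint, Finset.card_union_of_disjoint, hcard, hcard, hcard, weight]
  · rw [Finset.disjoint_left]
    intro p h1 h2
    have h1 := hmem _ _ _ h1
    have h2 := hmem _ _ _ h2
    simp only [Valid] at hs
    omega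
  · rw [Finset.disjoint_left]
    intro p h1 h2
    rw [Finset.mem_union] at h1
    have h1 := h1.imp (hmem _ _ _) (hmem _ _ _)
    have h2 := hmem _ _ _ h2
    simp only [Valid] at hs
    omega

end Rowmotion

/-! ### Order-reversing bijections -/

section Duality

variable {a : ℕ}

/-- The reversal of the positions of the fence. -/
def reverse (a : ℕ) : Equiv.Perm (TripleFence a) :=
  Fin.revPerm (n := [a, 1, a, 1, a].sum - 1)

theorem pos_reverse (x : TripleFence a) : (reverse a x).pos + x.pos = 3 * a := by
  have := pos_lt x
  change ([a, 1, a, 1, a].sum - 1) - (x.pos + 1) + x.pos = 3 * a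
  simp only [List.sum_cons, List.sum_nil]
  omega

/-- The reversal of the positions, as an order-reversing bijection. -/
def reverseOrderIso (ha : 2 ≤ a) : TripleFence a ≃o (TripleFence a)ᵒᵈ where
  toEquiv := (reverse a).trans OrderDual.toDual
  map_rel_iff' := by
    intro x y
    change reverse a y ≤ reverse a x ↔ x ≤ y
    have := pos_reverse x
    have := pos_reverse y
    rw [le_iff ha, le_iff ha]
    omega

theorem covBy_or_covBy_iff (ha : 2 ≤ a) {x y : TripleFence a} :
    (x ⋖ y ∨ y ⋖ x) ↔ (x.pos + 1 = y.pos ∨ y.pos + 1 = x.pos) := by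
  have key : ∀ {x y : TripleFence a}, x < y ↔ x ≤ y ∧ x.pos ≠ y.pos := fun {x y} =>
    lt_iff_le_and_ne.trans (and_congr_right fun _ => Fence.pos_injective.ne_iff.symm)
  have main : ∀ {x y : TripleFence a}, x ⋖ y → (x.pos + 1 = y.pos ∨ y.pos + 1 = x.pos) := by
    intro x y ⟨h, hc⟩
    have hy := pos_lt y
    -- If `y` were further to the right, the right neighbour of `x` would lie strictly between them.
    -- The minimum only keeps the position in range.
    obtain ⟨z, hz⟩ := exists_pos_eq (a := a) (p := min (x.pos + 1) (3 * a)) (by omega)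
    have hcz := @hc z
    rw [key, le_iff ha] at h
    rw [key, key, le_iff ha, le_iff ha] at hcz
    omega
  constructor
  · rintro (h | h)
    · exact main h
    · exact (main h).symm
  · intro h
    have hx := pos_lt x
    have hy := pos_lt y
    have hxy : x < y ∨ y < x := by
      rw [key, key, le_iff ha, le_iff ha]
      omega
    refine hxy.imp (fun h' => ⟨h', fun z h1 h2 => ?_⟩) fun h' => ⟨h', fun z h1 h2 => ?_⟩ <;>
    · rw [key, le_iff ha] at h1 h2
      omega

/-- An injective walk on the integers with unit steps is monotone. -/
theorem eq_add_or_add_eq (g : ℕ → ℕ) (n : ℕ)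
    (h1 : ∀ p < n, g p + 1 = g (p + 1) ∨ g (p + 1) + 1 = g p)
    (h2 : ∀ p, p + 1 < n → g (p + 1 + 1) ≠ g p) :
    (∀ p ≤ n, g p = g 0 + p) ∨ (∀ p ≤ n, g p + p = g 0) := by
  have up : n = 0 ∨ g 0 + 1 = g 1 → ∀ p ≤ n, g p = g 0 + p ∧ (p < n → g (p + 1) = g 0 + p + 1) := by
    intro h p
    induction p with
    | zero => intro _; rw [zero_add]; exact ⟨by omega, by omega⟩
    | succ p ih =>
      intro hp
      have := ih (by omega)
      refine ⟨by omega, fun hp' => ?_⟩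
      have := h1 (p + 1) hp'
      have := h2 p hp'
      omega
  have down : g 1 + 1 = g 0 → ∀ p ≤ n, g p + p = g 0 ∧ (p < n → g (p + 1) + p + 1 = g 0) := by
    intro h p
    induction p with
    | zero => intro _; rw [zero_add]; exact ⟨by omega, by omega⟩
    | succ p ih =>
      intro hp
      have := ih (by omega)
      refine ⟨by omega, fun hp' => ?_⟩
      have := h1 (p + 1) hp'
      have := h2 p hp'
      omega
  rcases Nat.eq_zero_or_pos n with h | h
  · exact Or.inl fun p hp => (up (Or.inl h) p hp).1
  · rcases h1 0 h with h | h
    · exact Or.inl fun p hp => (up (Or.inr h) p hp).1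
    · exact Or.inr fun p hp => (down h p hp).1

/-- The only order-reversing bijection of the fence is the reversal of positions. -/
theorem pos_orderIso (ha : 2 ≤ a) (κ : TripleFence a ≃o (TripleFence a)ᵒᵈ) (x : TripleFence a) :
    (OrderDual.ofDual (κ x)).pos + x.pos = 3 * a := by
  have hadj : ∀ x y : TripleFence a, x.pos + 1 = y.pos →
      (OrderDual.ofDual (κ x)).pos + 1 = (OrderDual.ofDual (κ y)).pos ∨
      (OrderDual.ofDual (κ y)).pos + 1 = (OrderDual.ofDual (κ x)).pos := by
    intro x y h
    rw [← covBy_or_covBy_iff ha, ofDual_covBy_ofDual_iff, ofDual_covBy_ofDual_iff,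
      apply_covBy_apply_iff, apply_covBy_apply_iff, or_comm, covBy_or_covBy_iff ha]
    exact Or.inl h
  choose X hX using fun p : Fin (3 * a + 1) => exists_pos_eq p.2
  let Y : ℕ → TripleFence a := fun p => X (Fin.ofNat (3 * a + 1) p)
  have hY : ∀ p ≤ 3 * a, (Y p).pos = p := fun p hp => by
    simp only [Y, hX, Fin.ofNat]
    exact Nat.mod_eq_of_lt (by omega)
  have hinj : ∀ p ≤ 3 * a, ∀ q ≤ 3 * a,
      (OrderDual.ofDual (κ (Y p))).pos = (OrderDual.ofDual (κ (Y q))).pos → p = q := by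
    intro p hp q hq h
    have := κ.injective (OrderDual.ofDual.injective (Fence.pos_injective h))
    rw [← hY p hp, ← hY q hq, this]
  have hxY : x = Y x.pos := Fence.pos_injective (hY _ (by have := pos_lt x; omega)).symm
  have hx := pos_lt x
  rcases eq_add_or_add_eq (fun p => (OrderDual.ofDual (κ (Y p))).pos) (3 * a)
    (fun p hp => hadj _ _ (by rw [hY p (by omega), hY (p + 1) (by omega)]))
    (fun p hp h => by have := hinj _ (by omega) _ (by omega) h; omega) with h | h
  -- An increasing walk would fix all positions, contradicting the reversal of the relation between
  -- positions 0 and 1.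
  · have h0 := h 0 (by omega)
    have h1 := h 1 (by omega)
    have hn := h (3 * a) le_rfl
    have := pos_lt (OrderDual.ofDual (κ (Y (3 * a))))
    have hle : Y 0 ≤ Y 1 := by
      rw [le_iff ha, hY 0 (by omega), hY 1 (by omega)]
      omega
    have hle' : OrderDual.ofDual (κ (Y 1)) ≤ OrderDual.ofDual (κ (Y 0)) := κ.monotone hle
    rw [le_iff ha] at hle'
    omega
  · have h0 := h (3 * a) le_rfl
    have h1 := h x.pos (by omega)
    have := pos_lt (OrderDual.ofDual (κ (Y 0)))
    rw [← hxY] at h1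
    omega

theorem idealComplement_ideal (ha : 2 ≤ a) (κ : TripleFence a ≃o (TripleFence a)ᵒᵈ)
    {s : ℕ × ℕ × ℕ} (hs : Valid a s) :
    idealComplement κ (ideal a s) = ideal a (comp a s) := by
  ext x
  change κ.symm (OrderDual.toDual x) ∉ ideal a s ↔ x ∈ ideal a (comp a s)
  have hp := pos_orderIso ha κ (κ.symm (OrderDual.toDual x))
  rw [OrderIso.apply_symm_apply, OrderDual.ofDual_toDual] at hp
  have hx := pos_lt x
  rw [mem_ideal ha hs, mem_ideal ha hs.comp]
  obtain ⟨i, j, k⟩ := s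
  simp only [Valid, comp] at hs ⊢
  omega

end Duality

/-! ### Orbits of permutations -/

section Orbits

variable {X : Type*} {f c : Equiv.Perm X} {x y : X}

theorem mem_orbit_zpowers_iff :
    y ∈ MulAction.orbit (Subgroup.zpowers f) x ↔ f.SameCycle x y := by
  constructor
  · rintro ⟨⟨_, i, rfl⟩, rfl⟩
    exact ⟨i, rfl⟩
  · rintro ⟨i, rfl⟩
    exact ⟨⟨f ^ i, i, rfl⟩, rfl⟩

theorem orbit_zpowers_eq_iff :
    MulAction.orbit (Subgroup.zpowers f) x = MulAction.orbit (Subgroup.zpowers f) y ↔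
      f.SameCycle x y := by
  rw [MulAction.orbit_eq_iff, mem_orbit_zpowers_iff]
  exact ⟨fun h => h.symm, fun h => h.symm⟩

theorem sameCycle_iterate (n : ℕ) : f.SameCycle x (f^[n] x) :=
  ⟨n, by rw [zpow_natCast, ← Equiv.Perm.iterate_eq_pow]⟩

theorem orbit_zpowers_eq_image {n : ℕ} (hn : 0 < n) (h : f^[n] x = x) :
    MulAction.orbit (Subgroup.zpowers f) x = (fun t => f^[t] x) '' (Finset.range n : Set ℕ) := by
  ext y
  rw [mem_orbit_zpowers_iff]
  constructor
  · rintro ⟨i, rfl⟩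
    have hn' : (n : ℤ) ≠ 0 := by omega
    refine ⟨(i % n).toNat, ?_, ?_⟩
    · have := Int.emod_lt_of_pos i (show (0 : ℤ) < n by omega)
      have := Int.emod_nonneg i hn'
      simp only [Finset.coe_range, Set.mem_Iio]
      omega
    · have hfix : ((f ^ n) ^ (i / n)) x = x := by
        apply Equiv.Perm.zpow_apply_eq_self_of_apply_eq_self
        rwa [← Equiv.Perm.iterate_eq_pow]
      have hi : f ^ i = f ^ ((i % n).toNat) * (f ^ n) ^ (i / n) := by
        rw [← zpow_natCast f n, ← zpow_natCast f, ← zpow_mul, ← zpow_add,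
          Int.toNat_of_nonneg (Int.emod_nonneg i hn'), Int.emod_add_mul_ediv]
      rw [hi, Equiv.Perm.mul_apply, hfix, ← Equiv.Perm.iterate_eq_pow]
  · rintro ⟨t, -, rfl⟩
    exact sameCycle_iterate t

theorem injOn_iterate {n : ℕ} (h : ∀ m, 0 < m → m < n → f^[m] x ≠ x) :
    Set.InjOn (fun t => f^[t] x) (Finset.range n : Set ℕ) := by
  have key : ∀ s t, t < n → s < t → f^[s] x ≠ f^[t] x := by
    intro s t ht hst he
    refine h (t - s) (by omega) (by omega) ((f.injective.iterate s) ?_)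
    rw [← Function.iterate_add_apply, Nat.add_sub_cancel' hst.le, he]
  intro s hs t ht he
  simp only [Finset.coe_range, Set.mem_Iio] at hs ht
  rcases lt_trichotomy s t with h' | h' | h'
  · exact absurd he (key s t ht h')
  · exact h'
  · exact absurd he.symm (key t s hs h')

/-- The orbits of a dihedral group, in terms of the orbits of the rotation `f` and of the
reflection `c`. -/
theorem orbit_closure_pair (hc : ∀ y, c (c y) = y) (hf : ∀ y, f (c (f y)) = c y) (x : X) :
    MulAction.orbit (Subgroup.closure {f, c}) x =
      MulAction.orbit (Subgroup.zpowers f) x ∪ MulAction.orbit (Subgroup.zpowers f) (c x) := by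
  have hcinv : c⁻¹ = c := by
    ext y
    rw [Equiv.Perm.inv_eq_iff_eq, hc]
  have hconj : c * f * c⁻¹ = f⁻¹ := by
    ext y
    rw [hcinv, Equiv.Perm.eq_inv_iff_eq, Equiv.Perm.mul_apply, Equiv.Perm.mul_apply, hf, hc]
  have hsc : ∀ {y z : X}, f.SameCycle (c y) (c z) ↔ f.SameCycle y z := by
    intro y z
    rw [← Equiv.Perm.sameCycle_inv (f := f), ← hconj, Equiv.Perm.sameCycle_conj, hcinv, hc, hc]
  ext y
  simp only [Set.mem_union, mem_orbit_zpowers_iff]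
  constructor
  · rintro ⟨⟨g, hg⟩, rfl⟩
    change f.SameCycle x (g x) ∨ f.SameCycle (c x) (g x)
    -- The union of the two cycles is invariant under `f`, and `c` swaps them; hence it is invariant
    -- under the whole group.
    have key : ∀ z, (f.SameCycle x (g z) ∨ f.SameCycle (c x) (g z)) ↔
        (f.SameCycle x z ∨ f.SameCycle (c x) z) := by
      induction hg using Subgroup.closure_induction with
      | mem g hg =>
        intro z
        rcases hg with rfl | rfl
        · rw [Equiv.Perm.sameCycle_apply_right, Equiv.Perm.sameCycle_apply_right]
        · rw [hsc, ← hsc, hc, or_comm]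
      | one => exact fun z => Iff.rfl
      | mul g g' _ _ h h' => exact fun z => (h (g' z)).trans (h' z)
      | inv g _ h =>
        intro z
        have := h (g⁻¹ z)
        rw [show g (g⁻¹ z) = z from g.apply_symm_apply z] at this
        exact this.symm
    exact (key x).2 (Or.inl (Equiv.Perm.SameCycle.refl _ _))
  · have hfmem : f ∈ Subgroup.closure {f, c} := Subgroup.subset_closure (by simp)
    have hcmem : c ∈ Subgroup.closure {f, c} := Subgroup.subset_closure (by simp)
    rintro (⟨i, rfl⟩ | ⟨i, rfl⟩)
    · exact ⟨⟨f ^ i, zpow_mem hfmem i⟩, rfl⟩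
    · exact ⟨⟨f ^ i * c, mul_mem (zpow_mem hfmem i) hcmem⟩, rfl⟩

end Orbits

/-! ### The orbits of rowmotion on the fence -/

section FenceOrbits

variable {a : ℕ}

theorem Valid.iterate (ha : 2 ≤ a) {s : ℕ × ℕ × ℕ} (hs : Valid a s) (n : ℕ) :
    Valid a ((FenceRowmotion.step a)^[n] s) := by
  induction n with
  | zero => exact hs
  | succ n ih =>
    rw [Function.iterate_succ_apply']
    exact ih.step ha

theorem iterate_rowmotion_antichain (ha : 2 ≤ a) {s : ℕ × ℕ × ℕ} (hs : Valid a s) (n : ℕ) :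
    (rowmotion (TripleFence a))^[n] (antichain a s) = antichain a ((step a)^[n] s) := by
  induction n with
  | zero => rfl
  | succ n ih =>
    rw [Function.iterate_succ_apply', ih, rowmotion_antichain ha (hs.iterate ha n),
      Function.iterate_succ_apply']

theorem iterate_idealRowmotion_ideal (ha : 2 ≤ a) {s : ℕ × ℕ × ℕ} (hs : Valid a s) (n : ℕ) :
    (idealRowmotion (TripleFence a))^[n] (ideal a s) = ideal a ((step a)^[n] s) := by
  induction n with
  | zero => rfl
  | succ n ih =>
    rw [Function.iterate_succ_apply', ih, idealRowmotion_ideal ha (hs.iterate ha n),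
      Function.iterate_succ_apply']

theorem sameCycle_antichain (ha : 2 ≤ a) {s t : ℕ × ℕ × ℕ} (hs : Valid a s) (ht : Valid a t)
    {n m : ℕ} (h : (step a)^[n] s = (step a)^[m] t) :
    (rowmotion (TripleFence a)).SameCycle (antichain a s) (antichain a t) := by
  have h1 := sameCycle_iterate (f := rowmotion (TripleFence a)) (x := antichain a s) n
  have h2 := sameCycle_iterate (f := rowmotion (TripleFence a)) (x := antichain a t) m
  rw [iterate_rowmotion_antichain ha hs, h] at h1
  rw [iterate_rowmotion_antichain ha ht] at h2
  exact h1.trans h2.symm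

theorem sameCycle_ideal (ha : 2 ≤ a) {s t : ℕ × ℕ × ℕ} (hs : Valid a s) (ht : Valid a t)
    {n m : ℕ} (h : (step a)^[n] s = (step a)^[m] t) :
    (idealRowmotion (TripleFence a)).SameCycle (ideal a s) (ideal a t) := by
  have h1 := sameCycle_iterate (f := idealRowmotion (TripleFence a)) (x := ideal a s) n
  have h2 := sameCycle_iterate (f := idealRowmotion (TripleFence a)) (x := ideal a t) m
  rw [iterate_idealRowmotion_ideal ha hs, h] at h1
  rw [iterate_idealRowmotion_ideal ha ht] at h2
  exact h1.trans h2.symm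

/-- The orbit of rowmotion on antichains with a given label. -/
def orb (a : ℕ) (o : OrbitLabel a) : Set (Antichains (TripleFence a)) :=
  MulAction.orbit (Subgroup.zpowers (rowmotion (TripleFence a))) (antichain a (rep a o))

/-- The orbit of rowmotion on ideals with a given label. -/
def idealOrb (a : ℕ) (o : OrbitLabel a) : Set (LowerSet (TripleFence a)) :=
  MulAction.orbit (Subgroup.zpowers (idealRowmotion (TripleFence a))) (ideal a (rep a o))

theorem size_pos (a : ℕ) (o : OrbitLabel a) : 0 < size a o := by
  rcases o with ⟨n, b⟩ | _ | v <;> simp only [size]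
  · omega
  · omega
  · have := v.pos
    positivity

theorem iterate_size_antichain (ha : 2 ≤ a) (o : OrbitLabel a) :
    (rowmotion (TripleFence a))^[size a o] (antichain a (rep a o)) = antichain a (rep a o) := by
  rw [iterate_rowmotion_antichain ha (rep_valid ha o), (run_rep ha o).iter]

theorem iterate_antichain_ne (ha : 2 ≤ a) {o o' : OrbitLabel a} {m : ℕ} (h0 : 0 < m)
    (hm : m < size a o) :
    (rowmotion (TripleFence a))^[m] (antichain a (rep a o)) ≠ antichain a (rep a o') := by
  rw [iterate_rowmotion_antichain ha (rep_valid ha o)]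
  intro h
  have h' := antichain_injOn ha ((rep_valid ha o).iterate ha m) (rep_valid ha o') h
  exact (run_rep ha o).avoid m h0 hm ⟨o', h'.symm⟩

/-- Within one period an orbit meets the representatives only at its start. -/
theorem orb_injective (ha : 2 ≤ a) : Function.Injective (orb a) := by
  intro o o' h
  have hmem : antichain a (rep a o') ∈ orb a o := by
    rw [h]
    exact MulAction.mem_orbit_self _
  rw [orb, orbit_zpowers_eq_image (size_pos a o) (iterate_size_antichain ha o)] at hmem
  obtain ⟨t, ht, hto⟩ := hmem
  simp only [Finset.coe_range, Set.mem_Iio] at ht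
  rcases Nat.eq_zero_or_pos t with rfl | h0
  · exact rep_injective ha (antichain_injOn ha (rep_valid ha o) (rep_valid ha o') hto)
  · exact absurd hto (iterate_antichain_ne ha h0 ht)

theorem ncard_orb (ha : 2 ≤ a) (o : OrbitLabel a) : (orb a o).ncard = size a o := by
  rw [orb, orbit_zpowers_eq_image (size_pos a o) (iterate_size_antichain ha o),
    (injOn_iterate fun m h0 hm => iterate_antichain_ne ha h0 hm).ncard_image,
    Set.ncard_coe_finset, Finset.card_range]

theorem statSum_orb (ha : 2 ≤ a) (o : OrbitLabel a) : statSum chi (orb a o) = total a o := by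
  rw [orb, orbit_zpowers_eq_image (size_pos a o) (iterate_size_antichain ha o), statSum,
    finsum_mem_image (injOn_iterate fun m h0 hm => iterate_antichain_ne ha h0 hm),
    finsum_mem_coe_finset, ← (run_rep ha o).sum, birkhoffSum]
  refine Finset.sum_congr rfl fun t _ => ?_
  rw [iterate_rowmotion_antichain ha (rep_valid ha o),
    chi_antichain ha ((rep_valid ha o).iterate ha t)]

theorem range_orb (ha : 2 ≤ a) : Set.range (orb a) = rowmotionOrbits (TripleFence a) := by
  ext O
  constructor
  · rintro ⟨o, rfl⟩
    exact ⟨_, rfl⟩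
  · rintro ⟨A, rfl⟩
    obtain ⟨s, hs, rfl⟩ := exists_antichain_eq ha A
    obtain ⟨o, n, m, h⟩ := exists_iterate_rep ha hs
    exact ⟨o, orbit_zpowers_eq_iff.2 (sameCycle_antichain ha hs (rep_valid ha o) h).symm⟩

/-- Passing from antichains to ideals conjugates the two rowmotions. It sends `antichain a s` to
`ideal a (step a s)`, one step ahead of `ideal a s` but on the same orbit. -/
theorem idealsOf_orb (ha : 2 ≤ a) (o : OrbitLabel a) : idealsOf (orb a o) = idealOrb a o := by
  have hs := rep_valid ha o
  have key : ∀ A B, (idealRowmotion (TripleFence a)).SameCycle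
      ((idealToAntichain _).symm A) ((idealToAntichain _).symm B) ↔
      (rowmotion (TripleFence a)).SameCycle A B := by
    intro A B
    have hconj : ∀ i : ℤ, ∀ A, (idealToAntichain _).symm ((rowmotion (TripleFence a) ^ i) A) =
        (idealRowmotion (TripleFence a) ^ i) ((idealToAntichain _).symm A) := by
      intro i A
      have h : idealRowmotion (TripleFence a) =
          (idealToAntichain _).symm.permCongrHom (rowmotion (TripleFence a)) := by
        ext I : 1
        simp [rowmotion, idealRowmotion, Equiv.permCongrHom]
      rw [h, ← map_zpow]
      simp [Equiv.permCongrHom]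
    refine exists_congr fun i => ?_
    rw [← hconj, (idealToAntichain _).symm.injective.eq_iff]
  ext I
  have h1 : I ∈ idealsOf (orb a o) ↔ idealToAntichain _ I ∈ orb a o := by
    constructor
    · rintro ⟨A, hA, rfl⟩
      rwa [Equiv.apply_symm_apply]
    · intro h
      exact ⟨_, h, Equiv.symm_apply_apply _ _⟩
  rw [h1, orb, idealOrb, mem_orbit_zpowers_iff, mem_orbit_zpowers_iff, ← key,
    idealToAntichain_symm_antichain ha hs, Equiv.symm_apply_apply, ← idealRowmotion_ideal ha hs,
    Equiv.Perm.sameCycle_apply_left]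

theorem idealOrb_injective (ha : 2 ≤ a) : Function.Injective (idealOrb a) := by
  intro o o' h
  rw [← idealsOf_orb ha, ← idealsOf_orb ha] at h
  exact orb_injective ha ((idealToAntichain _).symm.injective.image_injective h)

theorem eq_of_ideal_mem_idealOrb (ha : 2 ≤ a) {o o' : OrbitLabel a}
    (h : ideal a (rep a o) ∈ idealOrb a o') : o = o' :=
  idealOrb_injective ha (MulAction.orbit_eq_iff.2 h)

theorem range_superorbits (ha : 2 ≤ a) (κ : TripleFence a ≃o (TripleFence a)ᵒᵈ) :
    superorbits κ = Set.range fun o => idealOrb a o ∪ idealOrb a (dual a o) := by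
  have horbit : ∀ o, MulAction.orbit
      (Subgroup.closure {idealRowmotion (TripleFence a), idealComplement κ}) (ideal a (rep a o)) =
      idealOrb a o ∪ idealOrb a (dual a o) := by
    intro o
    have hs := rep_valid ha o
    rw [orbit_closure_pair]
    · obtain ⟨n, m, h⟩ := exists_iterate_comp_rep ha o
      rw [idealComplement_ideal ha κ hs,
        orbit_zpowers_eq_iff.2 (sameCycle_ideal ha hs.comp (rep_valid ha (dual a o)) h)]
      rfl
    · intro I
      obtain ⟨s, hs, rfl⟩ := exists_ideal_eq ha I
      rw [idealComplement_ideal ha κ hs, idealComplement_ideal ha κ hs.comp, comp_comp hs]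
    · intro I
      obtain ⟨s, hs, rfl⟩ := exists_ideal_eq ha I
      rw [idealRowmotion_ideal ha hs, idealComplement_ideal ha κ (hs.step ha),
        idealRowmotion_ideal ha (hs.step ha).comp, step_comp_step ha hs,
        idealComplement_ideal ha κ hs]
  ext O
  constructor
  · rintro ⟨I, rfl⟩
    obtain ⟨s, hs, rfl⟩ := exists_ideal_eq ha I
    obtain ⟨o, n, m, h⟩ := exists_iterate_rep ha hs
    refine ⟨o, ?_⟩
    dsimp only
    rw [← horbit, MulAction.orbit_eq_iff]
    obtain ⟨i, hi⟩ := sameCycle_ideal ha hs (rep_valid ha o) h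
    exact ⟨⟨_, zpow_mem (Subgroup.subset_closure (Set.mem_insert _ _)) i⟩, hi⟩
  · rintro ⟨o, rfl⟩
    exact ⟨_, horbit o⟩

end FenceOrbits

end FenceRowmotion

/-! ### The three classes of orbits -/

open FenceRowmotion in
theorem mainTheorem7 (a : ℕ) (ha : 2 ≤ a) :
    ∃ S M L : Set (Set (Antichains (Fence [a, 1, a, 1, a]))),
      -- the orbits are partitioned into three classes
      (S ∪ M ∪ L = rowmotionOrbits (Fence [a, 1, a, 1, a]) ∧
        Disjoint S M ∧ Disjoint S L ∧ Disjoint M L) ∧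
      -- number of orbits in each class, and their sizes
      (S.ncard = 2 * a - 2 ∧ M.ncard = 1 ∧ L.ncard = a) ∧
      ((∀ O ∈ S, O.ncard = a + 1) ∧
        (∀ O ∈ M, O.ncard = 3 * a + 2) ∧
        (∀ O ∈ L, O.ncard = a ^ 2 + 2 * a)) ∧
      -- the statistic on orbits
      ((∀ O ∈ S, statSum chi O = 3 * a) ∧
        (∀ O ∈ M, statSum chi O = 9 * a - 3) ∧
        (∀ O ∈ L, statSum chi O = 3 * a ^ 2 + 3 * a - 2)) ∧
      (a ≠ 2 →
        IsOrbomesic (Subgroup.zpowers (rowmotion (Fence [a, 1, a, 1, a]))) chi) ∧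
      -- the fence is self-dual, and for any order-reversing bijection the superorbits are
      -- the pairs of small orbits and the single medium and large orbits
      Nonempty (Fence [a, 1, a, 1, a] ≃o (Fence [a, 1, a, 1, a])ᵒᵈ) ∧
      ∀ κ : Fence [a, 1, a, 1, a] ≃o (Fence [a, 1, a, 1, a])ᵒᵈ,
        (∀ X ∈ superorbits κ,
          (∃ O ∈ M ∪ L, X = idealsOf O) ∨
          (∃ O₁ ∈ S, ∃ O₂ ∈ S, O₁ ≠ O₂ ∧ X = idealsOf O₁ ∪ idealsOf O₂)) ∧
        (∀ O ∈ M ∪ L, idealsOf O ∈ superorbits κ) ∧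
        (∀ O₁ ∈ S, ∃! O₂, O₂ ∈ S ∧ O₂ ≠ O₁ ∧ idealsOf O₁ ∪ idealsOf O₂ ∈ superorbits κ) := by
  have hinj := orb_injective ha
  have hinl : Function.Injective (fun p : Fin (a - 1) × Bool => orb a (.inl p)) :=
    hinj.comp Sum.inl_injective
  have hinr : Function.Injective (fun v : Fin a => orb a (.inr (.inr v))) :=
    hinj.comp (Sum.inr_injective.comp Sum.inr_injective)
  refine ⟨Set.range fun p => orb a (.inl p), {orb a (.inr (.inl ()))},
    Set.range fun v => orb a (.inr (.inr v)), ⟨?_, ?_, ?_, ?_⟩, ⟨?_, ?_, ?_⟩, ⟨?_, ?_, ?_⟩,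
    ⟨?_, ?_, ?_⟩, ?_, ⟨reverseOrderIso ha⟩, fun κ => ⟨?_, ?_, ?_⟩⟩
  · rw [← range_orb ha]
    ext O
    constructor
    · rintro ((⟨p, rfl⟩ | rfl) | ⟨v, rfl⟩) <;> exact ⟨_, rfl⟩
    · rintro ⟨p | ⟨⟨⟩⟩ | v, rfl⟩
      · exact Or.inl (Or.inl ⟨p, rfl⟩)
      · exact Or.inl (Or.inr rfl)
      · exact Or.inr ⟨v, rfl⟩
  · rw [Set.disjoint_left]
    rintro _ ⟨p, rfl⟩ h
    have := hinj h
    cases this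
  · rw [Set.disjoint_left]
    rintro _ ⟨p, rfl⟩ ⟨v, h⟩
    have := hinj h
    cases this
  · rw [Set.disjoint_left]
    rintro _ rfl ⟨v, h⟩
    have := hinj h
    cases this
  · rw [Set.ncard_range_of_injective hinl, Nat.card_eq_fintype_card, Fintype.card_prod,
      Fintype.card_fin, Fintype.card_bool]
    omega
  · exact Set.ncard_singleton _
  · rw [Set.ncard_range_of_injective hinr, Nat.card_eq_fintype_card, Fintype.card_fin]
  · rintro _ ⟨p, rfl⟩
    exact ncard_orb ha _
  · rintro _ rfl
    exact ncard_orb ha _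
  · rintro _ ⟨v, rfl⟩
    exact ncard_orb ha _
  · rintro _ ⟨p, rfl⟩
    exact statSum_orb ha _
  · rintro _ rfl
    exact statSum_orb ha _
  · rintro _ ⟨v, rfl⟩
    exact statSum_orb ha _
  · intro ha2 O₁ h₁ O₂ h₂ h
    change O₁ ∈ rowmotionOrbits (TripleFence a) at h₁
    change O₂ ∈ rowmotionOrbits (TripleFence a) at h₂
    rw [← range_orb ha] at h₁ h₂
    obtain ⟨o₁, rfl⟩ := h₁
    obtain ⟨o₂, rfl⟩ := h₂
    rw [ncard_orb ha, ncard_orb ha] at h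
    rw [statSum_orb ha, statSum_orb ha]
    -- This makes `a ^ 2 + 2 * a` exceed `3 * a + 2`, so the three sizes differ; for `a = 2` both
    -- equal 8 while the totals are 16 and 15.
    have h3 : 3 * a ≤ a ^ 2 := by
      have : 3 ≤ a := by omega
      nlinarith
    rcases o₁ with p | _ | v <;> rcases o₂ with q | _ | w <;> simp only [size, total] at h ⊢ <;>
      omega
  · rw [range_superorbits ha]
    rintro _ ⟨⟨n, b⟩ | o, rfl⟩
    · refine Or.inr ⟨_, ⟨(n, b), rfl⟩, _, ⟨(n, !b), rfl⟩, fun h => ?_, ?_⟩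
      · have := hinl h
        simp at this
      · rw [idealsOf_orb ha, idealsOf_orb ha]
        rfl
    · refine Or.inl ⟨orb a (.inr o), ?_, ?_⟩
      · rcases o with ⟨⟨⟩⟩ | v
        · exact Or.inl rfl
        · exact Or.inr ⟨v, rfl⟩
      · rw [idealsOf_orb ha]
        exact Set.union_self _
  · have key : ∀ o, idealsOf (orb a (.inr o)) ∈ superorbits κ := by
      intro o
      rw [range_superorbits ha, idealsOf_orb ha]
      exact ⟨.inr o, Set.union_self _⟩
    rintro _ (rfl | ⟨v, rfl⟩) <;> exact key _
  · rintro _ ⟨⟨n, b⟩, rfl⟩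
    refine ⟨orb a (dual a (.inl (n, b))), ⟨⟨(n, !b), rfl⟩, fun h => ?_, ?_⟩, ?_⟩
    · have := hinj h
      simp [dual] at this
    · rw [range_superorbits ha, idealsOf_orb ha, idealsOf_orb ha]
      exact ⟨_, rfl⟩
    · rintro _ ⟨⟨⟨m, b'⟩, rfl⟩, hne, h⟩
      rw [range_superorbits ha, idealsOf_orb ha, idealsOf_orb ha] at h
      obtain ⟨o, ho⟩ := h
      dsimp only at ho hne ⊢
      -- Both labels must be `o` or its dual; since the two orbits differ, the labels are dual to
      -- each other.
      have h1 : ideal a (rep a (.inl (n, b))) ∈ idealOrb a o ∪ idealOrb a (dual a o) := by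
        rw [ho]
        exact Or.inl (MulAction.mem_orbit_self _)
      have h2 : ideal a (rep a (.inl (m, b'))) ∈ idealOrb a o ∪ idealOrb a (dual a o) := by
        rw [ho]
        exact Or.inr (MulAction.mem_orbit_self _)
      have h1 := h1.imp (eq_of_ideal_mem_idealOrb ha) (eq_of_ideal_mem_idealOrb ha)
      have h2 := h2.imp (eq_of_ideal_mem_idealOrb ha) (eq_of_ideal_mem_idealOrb ha)
      rcases h1 with h1 | h1 <;> rcases h2 with h2 | h2
      · exact absurd (congrArg (orb a) (h2.trans h1.symm)) hne
      · rw [h1, h2]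
      · rw [h1, h2, dual_dual]
      · exact absurd (congrArg (orb a) (h2.trans h1.symm)) hne
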